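/- Let $X$ be a locally noetherian noncommutative space, i.e. a Grothendieck category $\operatorname{Mod} X$ (whose objects are called $X$-modules) with a set of noetherian generators. Let $\dim$ be a dimension function on $X$: a function from $X$-modules to ordinals together with $-1$ such that (i) $\dim M=-1$ iff $M=0$; (ii) $\dim N=\max\{\dim M,\dim K\}$ for every short exact sequence $0\to M\to N\to K\to 0$; (iii) $\dim N=\sup\{\dim N' : N'\le N \text{ noetherian}\}$; (iv) for $M$ noetherian and every strictly descending chain of submodules $M=M_0\supset M_1\supset\cdots$, $\dim M_i/M_{i+1}<\dim M$ for all but finitely many $i$. Suppose that $\dim X:=\sup\{\dim M: M\in\operatorname{Mod}X\}$ equals the ordinal $\alpha$ and that the Serre subcategory $\mathcal C_{<\alpha}=\{M:\dim M<\alpha\}$ is localizing, i.e. closed under (small) direct sums (this is automatic unless $\alpha$ is a limit ordinal). A module $M$ is $\alpha$-critical if $\dim M=\alpha$ and $\dim M/N<\alpha$ for every nonzero submodule $N\le M$. An indecomposable injective has critical dimension $\alpha$ if it has an $\alpha$-critical submodule. $\sigma[E]$ is the smallest full subcategory of $\operatorname{Mod}X$ that contains $E$ and is closed under isomorphisms,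 direct sums, subobjects and quotients. $Z_1\bullet Z_2$ is the full subcategory of all $N$ which admit a short exact sequence $0\to M_2\to N\to M_1\to 0$ with $M_i\in Z_i$. $\operatorname{Mod} D$ is the category of right $D$-modules, and $D(E)=\operatorname{End}(E)/J$ with $J$ the Jacobson radical of $\operatorname{End}(E)$ (the unique maximal ideal of this local ring when $E$ is an indecomposable injective). Then the following are equivalent: (a) $X/\mathcal C_{<\alpha}\simeq\operatorname{Mod}D$ for some division ring $D$. (b) There is an injective $\alpha$-critical $X$-module $E$ such that every indecomposable injective $X$-module of critical dimension $\alpha$ is isomorphic to $E$ (that is, up to isomorphism there is a unique indecomposable injective of critical dimension $\alpha$, and it is $\alpha$-critical). (c) There is an injective $\alpha$-critical $X$-module $E$ with $\operatorname{Mod}X=\sigma[E]\bullet\mathcal C_{<\alpha}$. Moreover, if these conditions hold, then for every injective $\alpha$-critical $X$-module $E$: every division ring $D$ as in (a) is isomorphic to $D(E)$, and $E$ is the injective hull of every $\alpha$-critical $X$-module. -/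

import Mathlib

open CategoryTheory CategoryTheory.Limits
open scoped ZeroObject

universe w v u

namespace NCSpace

section

variable {X : Type u} [Category.{v} X] [Abelian X]

/-- The space `X` is locally noetherian: it has a (small) set of noetherian generators. -/
def IsLocallyNoetherian (X : Type u) [Category.{v} X] : Prop :=
  ∃ (ι : Type v) (G : ι → X), (∀ i, IsNoetherianObject (G i)) ∧
    (ObjectProperty.ofObj G).IsSeparating

/-- The quotient `N / N'` for submodules `N' ≤ N` of a module `M`. -/
noncomputable abbrev subquotient {M : X} {N' N : Subobject M} (h : N' ≤ N) : X :=
  cokernel (Subobject.ofLE N' N h)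

/-- The quotient `M / N` of a module `M` by a submodule `N`. -/
noncomputable abbrev quotient {M : X} (N : Subobject M) : X :=
  cokernel N.arrow

/-- An (exact, finitely partitive) dimension function on `X`. The values are ordinals together
with `-1`, which is written `⊥` here. -/
structure DimensionFunction (X : Type u) [Category.{v} X] [Abelian X] where
  dim : X → WithBot Ordinal.{w}
  dim_eq_bot_iff : ∀ M : X, dim M = ⊥ ↔ IsZero M
  exact : ∀ S : ShortComplex X, S.ShortExact → dim S.X₂ = dim S.X₁ ⊔ dim S.X₃
  isLUB_noetherian : ∀ N : X,
    IsLUB {d | ∃ N' : Subobject N, IsNoetherianObject (N' : X) ∧ d = dim (N' : X)} (dim N)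
  finitely_partitive : ∀ (M : X) (f : ℕ → Subobject M) (hf : StrictAnti f),
    IsNoetherianObject M → f 0 = ⊤ →
      {i : ℕ | ¬ dim (subquotient (hf.antitone (Nat.le_succ i))) < dim M}.Finite

namespace DimensionFunction

variable (δ : DimensionFunction.{w} X)

/-- `dim X = α`, where `dim X` is the supremum of the dimensions of all `X`-modules. -/
def SpaceDimEq (α : Ordinal.{w}) : Prop :=
  IsLUB (Set.range δ.dim) (α : WithBot Ordinal.{w})

/-- The full subcategory `C_{<α}` of the modules of dimension less than `α`. -/
def ltSubcategory (α : Ordinal.{w}) : ObjectProperty X :=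
  fun M => δ.dim M < (α : WithBot Ordinal.{w})

instance (α : Ordinal.{w}) : (δ.ltSubcategory α).IsSerreClass where
  exists_zero := ⟨0, isZero_zero X, by
    have h : δ.dim (0 : X) = ⊥ := (δ.dim_eq_bot_iff _).2 (isZero_zero X)
    simp [ltSubcategory, h]⟩
  prop_of_mono {M N} f _ hN := by
    have h := δ.exact (ShortComplex.mk f (cokernel.π f) (cokernel.condition f))
      { exact := ShortComplex.exact_cokernel f }
    exact lt_of_le_of_lt (le_trans le_sup_left h.ge) hN
  prop_of_epi {M N} f _ hM := by
    have h := δ.exact (ShortComplex.mk (kernel.ι f) f (kernel.condition f))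
      { exact := ShortComplex.exact_kernel f }
    exact lt_of_le_of_lt (le_trans le_sup_right h.ge) hM
  prop_X₂_of_shortExact {S} hS h₁ h₃ := by
    have h := δ.exact S hS
    simp only [ltSubcategory] at *
    rw [h]
    exact max_lt h₁ h₃

/-- The quotient category `X / C_{<α}`, i.e. the localization of `X` at the morphisms whose kernel
and cokernel have dimension less than `α`. -/
abbrev QuotientCategory (α : Ordinal.{w}) :=
  (δ.ltSubcategory α).isoModSerre.Localization

/-- `M` is `α`-critical: `dim M = α`, and `dim M / N < α` for every nonzero submodule `N`. -/
def IsCritical (α : Ordinal.{w}) (M : X) : Prop :=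
  δ.dim M = (α : WithBot Ordinal.{w}) ∧
    ∀ N : Subobject M, N ≠ ⊥ → δ.dim (quotient N) < (α : WithBot Ordinal.{w})

/-- `E` is an indecomposable injective of critical dimension `α`, i.e. it has an `α`-critical
submodule. -/
def IsIndecInjectiveOfCriticalDim (α : Ordinal.{w}) (E : X) : Prop :=
  Injective E ∧ Indecomposable E ∧ ∃ N : Subobject E, δ.IsCritical α (N : X)

end DimensionFunction

/-- Weakly closed subspaces: full subcategories closed under isomorphisms, subobjects, quotients
and small direct sums. (Closure under isomorphisms is implied by closure under subobjects.) -/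
structure IsWeaklyClosed (P : ObjectProperty X) : Prop where
  subobjects : P.IsClosedUnderSubobjects
  quotients : P.IsClosedUnderQuotients
  directSums : ∀ J : Type v, P.IsClosedUnderColimitsOfShape (Discrete J)

/-- `σ[M]`, the smallest weakly closed subspace containing `M`. -/
def sigma (M : X) : ObjectProperty X :=
  fun N => ∀ P : ObjectProperty X, IsWeaklyClosed P → P M → P N

/-- The Gabriel product `Z₁ • Z₂`: the modules `N` which are the middle term of a short exact
sequence `0 ⟶ M₂ ⟶ N ⟶ M₁ ⟶ 0` with `M₁` in `Z₁` and `M₂` in `Z₂`. -/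
def gabrielProduct (Z₁ Z₂ : ObjectProperty X) : ObjectProperty X :=
  fun N => ∃ (M₂ M₁ : X) (f : M₂ ⟶ N) (g : N ⟶ M₁) (h : f ≫ g = 0),
    (ShortComplex.mk f g h).ShortExact ∧ Z₁ M₁ ∧ Z₂ M₂

/-- `i : M ⟶ E` is an injective hull: `E` is injective and `i` is an essential monomorphism. -/
structure IsInjectiveHull {M E : X} (i : M ⟶ E) : Prop where
  injective : Injective E
  mono : Mono i
  essential : ∀ {Z : X} (g : E ⟶ Z), Mono (i ≫ g) → Mono g

/-- `D(E) = End(E) / J`, where `J` is the Jacobson radical; for an indecomposable injective `E`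
the ring `End(E)` is local and `J` is its unique maximal ideal. The product in `End(E)` is
composition of functions, `f * g = f ∘ g`. -/
abbrev residueRing (E : X) : Type v :=
  End E ⧸ Ring.jacobson (End E)

end

end NCSpace

/-!
Write `P` for the localizing Serre class `C_{<α}` and `Q : X ⥤ X / P` for the quotient functor. The
proof uses little about the dimension function: since `dim X = α`, the `α`-critical modules are
those that are not in `P` while all their proper quotients are (`IsCriticalModulo`), and finite
partitivity gives a dévissage (`prop_of_isCriticalModulo`): a class of modules that contains `P` and
the critical modules and is closed under direct sums, quotients and extensions contains everything.

Let `E` be an injective critical module. A nonzero morphism from a critical module to a torsion-free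
one is a monomorphism, so `End E` is a division ring. Torsion-free injectives are local with respect
to the isomorphisms modulo `P`, so that `Hom(M, E) = Hom(Q M, Q E)` (`IsTorsionFree.map_bijective`).
As `X` is locally noetherian, direct sums of copies of `E` are again injective
(`injective_coproduct`) and torsion-free. All three conditions turn out to be equivalent to the
following one: for some injective critical `E`, each module is isomorphic to a direct sum of copies
of `E` in the quotient category (`IsSumModulo`).

* The modules with this property form a class that is closed under direct sums, submodules,
  quotients and extensions. For submodules and quotients one argues as for vector spaces: given a
  quotient `Z` of `∐ E`, Zorn's lemma provides a maximal subsum that embeds into `Z`, and the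
  cokernel is in `P` because proper quotients of `E` are. Hence the class contains `σ[E]`, and it is
  everything if and only if `σ[E] • P` is (`gabrielProduct_sigma_eq_top_iff`). By dévissage, it is
  also everything as soon as each critical module embeds into `E`, which is the case if `E` is the
  only indecomposable injective with a critical submodule.
* If the class is everything, then `X / P` is equivalent to the full subcategory of `X` on the
  direct sums of copies of `E`, and `Hom(E, -)` is an equivalence of the latter with the category of
  right vector spaces over `End E` (`exists_equivalence_moduleCat`).
* Conversely, let `X / P` be the category of vector spaces over a division ring `D`. Critical
  modules become nonzero vector spaces, so a critical `K` has a nonzero morphism to each injective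
  critical `E`; it is an injective hull of `K` (`IsCriticalModulo.exists_isInjectiveHull`). An
  injective critical module exists because the injective hull of a critical module is critical: in
  the quotient category the inclusion splits, and indecomposability of the hull makes it an
  isomorphism there (`IsInjectiveHull.isCriticalModulo_of_equivalence`). Finally, `End E` is a
  division ring and the endomorphism ring of the vector space `Q E`, which is therefore a line, so
  that `D` is isomorphic to `End E` and to `D(E)`.
-/

namespace NCSpace

/-! ### Subobjects, the axiom AB5 and injective hulls -/

section

variable {X : Type u} [Category.{v} X] [Abelian X]

theorem eq_bot_of_arrow_eq_zero {M : X} (S : Subobject M) (h : S.arrow = 0) : S = ⊥ := by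
  refine eq_bot_iff.2 (Subobject.le_of_comm 0 ?_)
  rw [zero_comp, h]

theorem disjoint_iff_factors {M : X} (a b : Subobject M) :
    Disjoint a b ↔ ∀ ⦃W : X⦄ (x : W ⟶ M), a.Factors x → b.Factors x → x = 0 := by
  rw [disjoint_iff]
  refine ⟨fun h W x ha hb => ?_, fun h => ?_⟩
  · have : (a ⊓ b).Factors x := (Subobject.inf_factors x).2 ⟨ha, hb⟩
    rw [h] at this
    exact (Subobject.bot_factors_iff_zero _).1 this
  · have h0 : (a ⊓ b).arrow = 0 :=
      h _ (Subobject.factors_of_le _ inf_le_left (Subobject.factors_self _))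
        (Subobject.factors_of_le _ inf_le_right (Subobject.factors_self _))
    exact eq_bot_of_arrow_eq_zero _ h0

theorem factors_iff_comp_cokernel_eq_zero {M W : X} (K : Subobject M) (x : W ⟶ M) :
    K.Factors x ↔ x ≫ cokernel.π K.arrow = 0 := by
  refine ⟨fun h => ?_, fun h => ?_⟩
  · rw [← Subobject.factorThru_arrow _ _ h, Category.assoc, cokernel.condition, comp_zero]
  · have := Subobject.factors_comp_arrow (Abelian.monoLift K.arrow x h)
    rwa [Abelian.monoLift_comp] at this

theorem eq_zero_of_iSup_eq_top {J : Type*} {L Z : X} [IsGrothendieckAbelian.{v} X]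
    (S : J → Subobject L) (h : ⨆ j, S j = ⊤) (f : L ⟶ Z) (hf : ∀ j, (S j).arrow ≫ f = 0) :
    f = 0 := by
  have : (⊤ : Subobject L) ≤ kernelSubobject f := by
    rw [← h, iSup_le_iff]
    intro j
    exact le_kernelSubobject _ _ (hf j)
  have h2 : (kernelSubobject f).Factors (𝟙 L) :=
    Subobject.factors_of_le _ this (Subobject.top_factors _)
  simpa using (kernelSubobject_factors_iff f (𝟙 L)).1 h2

theorem exists_eq_top_of_isNoetherianObject {J : Type*} {L : X} [IsGrothendieckAbelian.{v} X]
    [Preorder J] [IsDirectedOrder J] [Nonempty J] [IsNoetherianObject L]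
    (S : J → Subobject L) (hS : Monotone S) (h : ⨆ j, S j = ⊤) : ∃ j, S j = ⊤ := by
  obtain ⟨_, ⟨j, rfl⟩, hj⟩ := (wellFounded_gt (α := Subobject L)).has_min (Set.range S)
    (Set.range_nonempty S)
  refine ⟨j, top_le_iff.1 ?_⟩
  rw [← h, iSup_le_iff]
  intro k
  obtain ⟨l, hjl, hkl⟩ := exists_ge_ge j k
  have := hj (S l) ⟨l, rfl⟩
  have h3 : S j = S l := eq_of_le_of_not_lt (hS hjl) this
  exact h3 ▸ hS hkl

/-- The axiom AB5 in terms of subobjects: inverse images commute with directed unions. -/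
theorem iSup_pullback_eq_top [IsGrothendieckAbelian.{v} X]
    {J : Type v} [Preorder J] [IsDirectedOrder J] [Nonempty J]
    {M L : X} (S : J → Subobject M) (hS : Monotone S) (z : L ⟶ M)
    (hz : (⨆ j, S j).Factors z) :
    ⨆ j, (Subobject.pullback z).obj (S j) = ⊤ := by
  let T := ⨆ j, S j
  let F : J ⥤ MonoOver M := hS.functor ⋙ Subobject.representative
  let c : Cocone (F ⋙ MonoOver.forget _) :=
    { pt := Over.mk T.arrow
      ι :=
        { app := fun j => Over.homMk (Subobject.ofLE (S j) T (le_iSup S j))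
            (Subobject.ofLE_arrow _)
          naturality := fun i j f => by
            apply Over.OverMorphism.ext
            rw [← cancel_mono T.arrow]
            have h1 := MonoOver.w (F.map f)
            change ((F.map f).hom.left ≫ Subobject.ofLE _ _ _) ≫ T.arrow
              = (Subobject.ofLE _ _ _ ≫ 𝟙 _) ≫ T.arrow
            rw [Category.comp_id]
            refine (Category.assoc _ _ _).trans ?_
            refine (congrArg _ (Subobject.ofLE_arrow (le_iSup S j))).trans ?_
            exact h1.trans (Subobject.ofLE_arrow (le_iSup S i)).symm } }
  have hcm : Mono c.pt.hom := inferInstanceAs (Mono T.arrow)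
  have hmk : Subobject.mk c.pt.hom = ⨆ j, Subobject.mk (F.obj j).obj.hom := by
    change Subobject.mk T.arrow = ⨆ j, Subobject.mk (S j).arrow
    simp only [Subobject.mk_arrow]
    rfl
  have hc := IsGrothendieckAbelian.isColimitMapCoconeOfSubobjectMkEqISup F c hmk
  let c' := (Over.forget M).mapCocone c
  have : ∀ j, Mono (c'.ι.app j) := fun j => inferInstanceAs (Mono (Subobject.ofLE (S j) T _))
  have : Mono c'.ι := NatTrans.mono_of_mono_app _
  let z' : L ⟶ c'.pt := T.factorThru z hz
  have hz' : z' ≫ T.arrow = z := Subobject.factorThru_arrow _ _ _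
  have hiso := IsGrothendieckAbelian.IsPresentable.surjectivity.isIso_f (c := c') hc z'
  have hmono := IsGrothendieckAbelian.mono_of_isColimit_monoOver
    (IsGrothendieckAbelian.IsPresentable.surjectivity.F z') (colimit.isColimit _)
    (IsGrothendieckAbelian.IsPresentable.surjectivity.f z')
    (IsGrothendieckAbelian.IsPresentable.surjectivity.hf z')
  have key := IsGrothendieckAbelian.subobjectMk_of_isColimit_eq_iSup
    (IsGrothendieckAbelian.IsPresentable.surjectivity.F z') (colimit.isColimit _)
    (IsGrothendieckAbelian.IsPresentable.surjectivity.f z')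
    (IsGrothendieckAbelian.IsPresentable.surjectivity.hf z')
  have key' := key.symm.trans ((Subobject.isIso_iff_mk_eq_top _).1 hiso)
  refine top_le_iff.1 (key'.symm.trans_le ?_)
  refine iSup_le ?_
  intro j
  refine le_iSup_of_le j ?_
  have hw : (pullback.fst c'.ι ((Functor.const J).map z')).app j ≫ c'.ι.app j =
      (pullback.snd c'.ι ((Functor.const J).map z')).app j ≫ z' := by
    have := NatTrans.congr_app (pullback.condition (f := c'.ι) (g := (Functor.const J).map z')) j
    exact this
  have hw2 : (pullback.fst c'.ι ((Functor.const J).map z')).app j ≫ (S j).arrow =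
      (pullback.snd c'.ι ((Functor.const J).map z')).app j ≫ z := by
    have h4 : c'.ι.app j ≫ T.arrow = (S j).arrow := Subobject.ofLE_arrow (le_iSup S j)
    refine (congrArg _ h4.symm).trans ((Category.assoc _ _ _).symm.trans ?_)
    exact (congrArg (· ≫ T.arrow) hw).trans ((Category.assoc _ _ _).trans (congrArg _ hz'))
  refine Subobject.le_of_comm ((Subobject.underlyingIso _).hom ≫
    (Subobject.isPullback z (S j)).lift _ _ hw2) ?_
  refine (Category.assoc _ _ _).trans ?_
  refine (congrArg _ ((Subobject.isPullback z (S j)).lift_snd _ _ hw2)).trans ?_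
  exact Subobject.underlyingIso_hom_comp_eq_mk _

/-- Zorn's lemma for complements: a subobject disjoint from `a` is contained in one that is
maximal among the subobjects disjoint from `a`. -/
theorem exists_maximal_disjoint [IsGrothendieckAbelian.{v} X] {M : X} (a b₀ : Subobject M)
    (h₀ : Disjoint a b₀) : ∃ b, b₀ ≤ b ∧ Maximal (Disjoint a) b := by
  refine zorn_le_nonempty₀ {b | Disjoint a b} (fun c hc hchain y hy => ?_) b₀ h₀
  refine ⟨sSup c, ?_, fun z hz => le_sSup hz⟩
  let e := equivShrink.{v} c
  let _ : Preorder (Shrink.{v} c) := Preorder.lift e.symm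
  have : Nonempty (Shrink.{v} c) := ⟨e ⟨y, hy⟩⟩
  have : IsDirectedOrder (Shrink.{v} c) := ⟨fun i j => by
    rcases hchain.total (e.symm i).2 (e.symm j).2 with h | h
    · exact ⟨j, h, le_refl j⟩
    · exact ⟨i, le_refl i, h⟩⟩
  let S : Shrink.{v} c → Subobject M := fun i => (e.symm i).1
  have hS : ⨆ i, S i = sSup c := by
    rw [sSup_eq_iSup']
    exact e.symm.iSup_congr (fun _ => rfl)
  refine (disjoint_iff_factors _ _).2 (fun W x hxa hxc => ?_)
  have htop := iSup_pullback_eq_top S (fun i j h => h) x (by rwa [hS])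
  refine eq_zero_of_iSup_eq_top _ htop x (fun j => ?_)
  refine (disjoint_iff_factors _ _).1 (hc (e.symm j).2) _ ?_ ?_
  · exact Subobject.factors_of_factors_right _ hxa
  · exact (Subobject.factors_iff _ _).2 ⟨Subobject.pullbackπ x _, (Subobject.isPullback x _).w⟩

/-- Every object of a Grothendieck category has an injective hull. For `M` a subobject of an
injective object `I` and `K ≤ I` maximal with `K ⊓ M = ⊥`, the quotient `I / K` is an essential
extension of `M`. It is mapped isomorphically to a subobject `J` of `I` with `I = J ⊕ K`, so it is
injective. -/
theorem exists_isInjectiveHull [IsGrothendieckAbelian.{v} X] (M : X) :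
    ∃ (E : X) (i : M ⟶ E), IsInjectiveHull i := by
  obtain ⟨⟨I, hI, m, hm⟩⟩ := EnoughInjectives.presentation M
  obtain ⟨K, -, hK⟩ := exists_maximal_disjoint (Subobject.mk m) ⊥ disjoint_bot_right
  obtain ⟨J, haJ, hJ⟩ := exists_maximal_disjoint K (Subobject.mk m) hK.prop.symm
  let q : I ⟶ cokernel K.arrow := cokernel.π K.arrow
  have hq : ∀ {W : X} (x : W ⟶ I), x ≫ q = 0 → K.Factors x := fun x hx =>
    (factors_iff_comp_cokernel_eq_zero K x).2 hx
  have hmJ : J.Factors m := Subobject.factors_of_le _ haJ (Subobject.mk_factors_self m)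
  -- by maximality of `K`, the quotient by `K` is an essential extension of `M`
  have hess : ∀ {Z : X} (g : cokernel K.arrow ⟶ Z), Mono ((m ≫ q) ≫ g) → Mono g := by
    intro Z g hg
    have hle : K ≤ kernelSubobject (q ≫ g) :=
      le_kernelSubobject _ _ (by simp [q])
    have hdis : Disjoint (Subobject.mk m) (kernelSubobject (q ≫ g)) := by
      refine (disjoint_iff_factors _ _).2 (fun W x hx1 hx2 => ?_)
      have h1 : x ≫ q ≫ g = 0 := (kernelSubobject_factors_iff _ _).1 hx2
      obtain ⟨y, hy⟩ : ∃ y, y ≫ m = x := (Subobject.mk_factors_iff _ _).1 hx1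
      rw [← hy] at h1 ⊢
      have : y ≫ ((m ≫ q) ≫ g) = 0 := by simpa using h1
      rw [Preadditive.mono_iff_cancel_zero] at hg
      rw [hg _ _ this, zero_comp]
    have hle' := hK.2 hdis hle
    rw [Preadditive.mono_iff_cancel_zero]
    intro W y hy
    -- lift `y` along the epimorphism `q`
    let p := pullback.fst y q
    have : Epi p := inferInstance
    have h1 : (pullback.snd y q) ≫ q ≫ g = 0 := by
      rw [← Category.assoc, ← pullback.condition, Category.assoc, hy, comp_zero]
    have h2 : K.Factors (pullback.snd y q) :=
      Subobject.factors_of_le _ hle' ((kernelSubobject_factors_iff _ _).2 h1)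
    have h3 : pullback.snd y q ≫ q = 0 := by
      rw [← Subobject.factorThru_arrow _ _ h2, Category.assoc]
      simp [q]
    rw [← cancel_epi p, comp_zero, pullback.condition, h3]
  have hJq : Mono (J.arrow ≫ q) := by
    rw [Preadditive.mono_iff_cancel_zero]
    intro W y hy
    rw [← cancel_mono J.arrow, zero_comp]
    exact (disjoint_iff_factors _ _).1 hJ.prop _ (hq _ (by simpa using hy))
      (Subobject.factors_comp_arrow _)
  obtain ⟨h, hh⟩ : ∃ h : cokernel K.arrow ⟶ I, (J.arrow ≫ q) ≫ h = J.arrow :=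
    ⟨Injective.factorThru J.arrow (J.arrow ≫ q), Injective.comp_factorThru _ _⟩
  have hmh : (m ≫ q) ≫ h = m := by
    have := congrArg (fun t => J.factorThru m hmJ ≫ t) hh
    simpa only [← Category.assoc, Subobject.factorThru_arrow] using this
  have hmq : Mono (m ≫ q) := by
    have : Mono ((m ≫ q) ≫ h) := by rw [hmh]; infer_instance
    exact mono_of_mono _ h
  have hhm : Mono h := hess h (by rw [hmh]; infer_instance)
  have hhq : Mono (h ≫ q) := hess _ (by rw [← Category.assoc, hmh]; infer_instance)
  -- `h` extends the inclusion of `J`, and its image meets `K` trivially because `h ≫ q` is mono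
  have hle : Subobject.mk h ≤ J := by
    refine hJ.2 ?_ (Subobject.le_mk_of_comm (J.arrow ≫ q) hh)
    refine (disjoint_iff_factors _ _).2 (fun W x hx1 hx2 => ?_)
    obtain ⟨y, hy⟩ : ∃ y, y ≫ h = x := (Subobject.mk_factors_iff _ _).1 hx2
    have hxq : x ≫ q = 0 := by
      rw [← Subobject.factorThru_arrow _ _ hx1, Category.assoc]
      simp [q]
    rw [← hy, Category.assoc] at hxq
    rw [← hy, (Preadditive.mono_iff_cancel_zero _).1 hhq _ _ hxq, zero_comp]
  have hhJ : J.Factors h := Subobject.factors_of_le _ hle (Subobject.mk_factors_self h)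
  obtain ⟨r, hr⟩ : ∃ r, r ≫ J.arrow = h := ⟨J.factorThru h hhJ, Subobject.factorThru_arrow _ _ _⟩
  have h1 : (J.arrow ≫ q) ≫ r = 𝟙 _ := by
    rw [← cancel_mono J.arrow, Category.assoc, hr, hh, Category.id_comp]
  have h2 : r ≫ (J.arrow ≫ q) = 𝟙 _ := by
    have : Mono r := by
      have : Mono (r ≫ J.arrow) := by rw [hr]; infer_instance
      exact mono_of_mono r J.arrow
    rw [← cancel_mono r, Category.assoc, h1, Category.comp_id, Category.id_comp]
  have hinj : Injective (cokernel K.arrow) := ⟨fun {A B} g f _ => by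
    refine ⟨Injective.factorThru (g ≫ h) f ≫ q, ?_⟩
    rw [← Category.assoc, Injective.comp_factorThru, Category.assoc, ← hr, Category.assoc, h2,
      Category.comp_id]⟩
  exact ⟨_, m ≫ q, hinj, hmq, hess⟩

end

/-! ### Torsion-free and critical objects modulo a Serre class -/

section

variable {X : Type u} [Category.{v} X] [Abelian X]

/-- `M` is torsion-free with respect to `P`: it has no nonzero submodule in `P`. As `P` is going to
be closed under quotients, this is phrased with arbitrary morphisms from objects of `P`. -/
def IsTorsionFree (P : ObjectProperty X) (M : X) : Prop :=
  ∀ ⦃N : X⦄ (f : N ⟶ M), P N → f = 0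

/-- `M` is critical modulo `P`: it is not in `P`, but all its proper quotients are. For `P` the
subcategory `C_{<α}` of a space of dimension `α`, these are the `α`-critical modules. -/
def IsCriticalModulo (P : ObjectProperty X) (M : X) : Prop :=
  ¬ P M ∧ ∀ ⦃N : X⦄ (f : N ⟶ M), f ≠ 0 → P (cokernel f)

/-- An injective subobject is a direct summand, and an indecomposable object has no proper ones. -/
theorem isIso_of_indecomposable_of_mono {E E' : X} (hE : Injective E) (hE0 : ¬ IsZero E)
    (hE' : Indecomposable E') (f : E ⟶ E') [Mono f] : IsIso f := by
  obtain ⟨r, hr⟩ : ∃ r : E' ⟶ E, f ≫ r = 𝟙 E :=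
    ⟨Injective.factorThru (𝟙 E) f, Injective.comp_factorThru _ _⟩
  have hlift : (𝟙 E' - r ≫ f) ≫ r = 0 := by
    simp [Preadditive.sub_comp, hr]
  let e : E' ≅ E ⊞ kernel r :=
    { hom := biprod.lift r (kernel.lift r (𝟙 E' - r ≫ f) hlift)
      inv := biprod.desc f (kernel.ι r)
      hom_inv_id := by simp [biprod.lift_desc]
      inv_hom_id := by
        apply biprod.hom_ext'
        · apply biprod.hom_ext
          · simp [hr]
          · rw [← cancel_mono (kernel.ι r)]
            simp [Preadditive.comp_sub, reassoc_of% hr]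
        · apply biprod.hom_ext
          · simp
          · rw [← cancel_mono (kernel.ι r)]
            simp [Preadditive.comp_sub] }
  have hz : IsZero (kernel r) := (hE'.2 _ _ e).resolve_left hE0
  refine ⟨r, hr, ?_⟩
  have h1 : kernel.lift r (𝟙 E' - r ≫ f) hlift = 0 := hz.eq_of_tgt _ _
  have h2 := kernel.lift_ι r (𝟙 E' - r ≫ f) hlift
  rw [h1, zero_comp] at h2
  exact (sub_eq_zero.1 h2.symm).symm

/-- An indecomposable injective object is an injective hull of each of its nonzero subobjects. -/
theorem IsInjectiveHull.of_indecomposable [IsGrothendieckAbelian.{v} X] {K E : X}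
    (hE : Injective E) (hE' : Indecomposable E) (k : K ⟶ E) [Mono k] (hK : ¬ IsZero K) :
    IsInjectiveHull k := by
  obtain ⟨H, i, hi⟩ := exists_isInjectiveHull K
  have := hi.mono
  obtain ⟨h, hh⟩ : ∃ h, i ≫ h = k := ⟨Injective.factorThru k i, Injective.comp_factorThru _ _⟩
  have : Mono h := hi.essential h (by rw [hh]; infer_instance)
  have hH : ¬ IsZero H := fun hz => hK (hz.of_mono i)
  have := isIso_of_indecomposable_of_mono hi.injective hH hE' h
  refine ⟨hE, inferInstance, fun g hg => ?_⟩
  have h1 : Mono (h ≫ g) := hi.essential _ (by rw [← Category.assoc, hh]; exact hg)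
  have : g = inv h ≫ (h ≫ g) := by simp
  rw [this]
  infer_instance

theorem IsTorsionFree.of_mono {P : ObjectProperty X} {M N : X} (hN : IsTorsionFree P N)
    (f : M ⟶ N) [Mono f] : IsTorsionFree P M := fun W g hW => by
  rw [← cancel_mono f, zero_comp]
  exact hN _ hW

/-- A nonzero morphism with a nonzero kernel would have a nonzero image that lies in `P`. -/
theorem IsCriticalModulo.mono_of_ne_zero {P : ObjectProperty X} {M T : X}
    (hM : IsCriticalModulo P M) (hT : IsTorsionFree P T) (f : M ⟶ T) (hf : f ≠ 0) : Mono f := by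
  apply Preadditive.mono_of_kernel_zero
  by_contra h
  apply hf
  have := hT (cokernel.desc (kernel.ι f) f (kernel.condition f)) (hM.2 _ h)
  rw [← cokernel.π_desc (kernel.ι f) f (kernel.condition f), this, comp_zero]

section Serre

variable {P : ObjectProperty X} [P.IsSerreClass]

theorem prop_cokernel_of_epi_comp {A B C : X} {f : A ⟶ C} (e : A ⟶ B) [Epi e] (g : B ⟶ C)
    (h : e ≫ g = f) (hg : P (cokernel g)) : P (cokernel f) :=
  P.prop_of_epi (cokernel.desc g (cokernel.π f) (by
    rw [← cancel_epi e, ← Category.assoc, h, cokernel.condition, comp_zero])) hg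

theorem IsCriticalModulo.not_isZero {M : X} (hM : IsCriticalModulo P M) : ¬ IsZero M :=
  fun h => hM.1 (P.prop_of_isZero h)

theorem IsCriticalModulo.isTorsionFree {M : X} (hM : IsCriticalModulo P M) :
    IsTorsionFree P M := fun N f hN => by
  by_contra hf
  exact hM.1 (P.prop_X₂_of_exact (ShortComplex.exact_cokernel f) hN (hM.2 f hf))

theorem IsCriticalModulo.of_iso {M N : X} (hM : IsCriticalModulo P M) (e : M ≅ N) :
    IsCriticalModulo P N := by
  refine ⟨fun h => hM.1 (P.prop_of_iso e.symm h), fun A f hf => ?_⟩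
  have h0 : f ≫ e.inv ≠ 0 := fun h => hf (by rw [← cancel_mono e.inv, h, zero_comp])
  exact P.prop_of_iso (cokernelCompIsIso f e.inv) (hM.2 _ h0)

theorem IsCriticalModulo.essential {K E : X} (hE : IsCriticalModulo P E) (i : K ⟶ E) (hi : i ≠ 0)
    {Z : X} (g : E ⟶ Z) (hg : Mono (i ≫ g)) : Mono g := by
  apply Preadditive.mono_of_kernel_zero
  by_contra h
  apply hi
  have h1 : (i ≫ cokernel.π (kernel.ι g)) ≫ cokernel.desc (kernel.ι g) g (kernel.condition g)
      = i ≫ g := by simp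
  have : Mono (i ≫ cokernel.π (kernel.ι g)) := by
    have : Mono ((i ≫ cokernel.π (kernel.ι g)) ≫
      cokernel.desc (kernel.ι g) g (kernel.condition g)) := by rw [h1]; exact hg
    exact mono_of_mono _ (cokernel.desc (kernel.ι g) g (kernel.condition g))
  exact hE.isTorsionFree i (P.prop_of_mono (i ≫ cokernel.π (kernel.ι g)) (hE.2 _ h))

theorem IsCriticalModulo.isInjectiveHull {K E : X} (hE : IsCriticalModulo P E) (hEi : Injective E)
    (i : K ⟶ E) [Mono i] (hi : i ≠ 0) : IsInjectiveHull i :=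
  ⟨hEi, inferInstance, fun g hg => hE.essential i hi g hg⟩

theorem IsInjectiveHull.isTorsionFree {M H : X} {i : M ⟶ H} (hi : IsInjectiveHull i)
    (hM : IsTorsionFree P M) : IsTorsionFree P H := fun N f hN => by
  have := hi.mono
  have hg : Mono (i ≫ cokernel.π f) := by
    apply Preadditive.mono_of_kernel_zero
    apply hM
    have hw : (kernel.ι (i ≫ cokernel.π f) ≫ i) ≫ cokernel.π f = 0 := by
      rw [Category.assoc, kernel.condition]
    have : Mono (kernel.lift (cokernel.π f) _ hw) := by
      have : Mono (kernel.lift (cokernel.π f) _ hw ≫ kernel.ι (cokernel.π f)) := by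
        rw [kernel.lift_ι]; infer_instance
      exact mono_of_mono _ (kernel.ι (cokernel.π f))
    exact P.prop_of_mono (kernel.lift (cokernel.π f) _ hw)
      (P.prop_of_epi (Abelian.factorThruImage f) hN)
  have := hi.essential _ hg
  rw [← cancel_mono (cokernel.π f), cokernel.condition, zero_comp]

theorem IsInjectiveHull.indecomposable {M H : X} {i : M ⟶ H} (hi : IsInjectiveHull i)
    (hM : IsCriticalModulo P M) : Indecomposable H := by
  have := hi.mono
  have hH := hi.isTorsionFree hM.isTorsionFree
  refine ⟨fun h => hM.not_isZero (h.of_mono i), fun Y Z a => ?_⟩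
  have hY : IsTorsionFree P Y := hH.of_mono (biprod.inl ≫ a.inv)
  have hZ : IsTorsionFree P Z := hH.of_mono (biprod.inr ≫ a.inv)
  by_cases hp : i ≫ a.hom ≫ biprod.fst = 0
  · by_cases hq : i ≫ a.hom ≫ biprod.snd = 0
    · exfalso
      have h0 : i ≫ a.hom = 0 := biprod.hom_ext _ _ (by simpa using hp) (by simpa using hq)
      have : i = 0 := by rw [← cancel_mono a.hom, h0, zero_comp]
      exact hM.not_isZero (IsZero.of_mono_eq_zero i this)
    · left
      have := hi.essential _ (hM.mono_of_ne_zero hZ _ hq)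
      have h0 : biprod.inl ≫ a.inv = 0 := by
        rw [← cancel_mono (a.hom ≫ biprod.snd)]
        simp
      exact IsZero.of_mono_eq_zero (biprod.inl ≫ a.inv) h0
  · right
    have := hi.essential _ (hM.mono_of_ne_zero hY _ hp)
    have h0 : biprod.inr ≫ a.inv = 0 := by
      rw [← cancel_mono (a.hom ≫ biprod.fst)]
      simp
    exact IsZero.of_mono_eq_zero (biprod.inr ≫ a.inv) h0

theorem IsCriticalModulo.indecomposable {E : X} (hE : IsCriticalModulo P E) (hEi : Injective E) :
    Indecomposable E :=
  have h0 : 𝟙 E ≠ 0 := fun h => hE.not_isZero ((IsZero.iff_id_eq_zero E).2 h)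
  (hE.isInjectiveHull hEi (𝟙 E) h0).indecomposable hE

/-- The form of Schur's lemma for injective critical modules. -/
theorem IsCriticalModulo.isIso_of_ne_zero {E : X} (hE : IsCriticalModulo P E) (hEi : Injective E)
    (f : E ⟶ E) (hf : f ≠ 0) : IsIso f := by
  have := hE.mono_of_ne_zero hE.isTorsionFree f hf
  exact isIso_of_indecomposable_of_mono hEi hE.not_isZero (hE.indecomposable hEi) f

theorem IsTorsionFree.exists_comp_eq {E : X} (hE : IsTorsionFree P E) (hEi : Injective E)
    {A B : X} (s : A ⟶ B) (hs : P.monoModSerre s) (f : A ⟶ E) : ∃ g : B ⟶ E, s ≫ g = f := by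
  have h0 : kernel.ι s ≫ f = 0 := hE _ hs
  refine ⟨Injective.factorThru (cokernel.desc (kernel.ι s) f h0) (Abelian.factorThruCoimage s), ?_⟩
  have h1 : Abelian.coimage.π s ≫ Abelian.factorThruCoimage s = s := Abelian.coimage.fac s
  refine (congrArg (· ≫ _) h1.symm).trans ?_
  rw [Category.assoc, Injective.comp_factorThru, cokernel.π_desc]

theorem IsTorsionFree.eq_of_comp_eq {E : X} (hE : IsTorsionFree P E)
    {A B : X} (s : A ⟶ B) (hs : P.epiModSerre s) (f g : B ⟶ E) (h : s ≫ f = s ≫ g) : f = g := by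
  have h0 : s ≫ (f - g) = 0 := by rw [Preadditive.comp_sub, h, sub_self]
  have := hE (cokernel.desc s (f - g) h0) hs
  rw [← sub_eq_zero, ← cokernel.π_desc s (f - g) h0, this, comp_zero]

/-- A torsion-free injective object is local with respect to the isomorphisms modulo `P`, so
morphisms into it may be computed in the quotient category. -/
theorem IsTorsionFree.map_bijective {E : X} (hE : IsTorsionFree P E) (hEi : Injective E) (M : X) :
    Function.Bijective (fun f : M ⟶ E => P.isoModSerre.Q.map f) := by
  refine ⟨fun f g h => ?_, fun g => ?_⟩
  · obtain ⟨Z, s, hs, h⟩ :=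
      (MorphismProperty.map_eq_iff_precomp P.isoModSerre.Q P.isoModSerre f g).1 h
    exact hE.eq_of_comp_eq s hs.2 f g h
  · obtain ⟨φ, hφ⟩ := Localization.exists_rightFraction P.isoModSerre.Q P.isoModSerre g
    obtain ⟨f, hf⟩ := hE.exists_comp_eq hEi φ.s φ.hs.1 φ.f
    refine ⟨f, ?_⟩
    have := Localization.inverts P.isoModSerre.Q P.isoModSerre φ.s φ.hs
    rw [← cancel_epi (P.isoModSerre.Q.map φ.s)]
    dsimp only
    rw [← Functor.map_comp, hf, hφ, MorphismProperty.RightFraction.map_s_comp_map]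

end Serre

end

/-! ### Coproducts of injective objects -/

section

variable {X : Type u} [Category.{v} X] [Abelian X] [IsGrothendieckAbelian.{v} X]

section Coproducts

open scoped Classical

variable {I : Type v} (A : I → X)

/-- The idempotent endomorphism of a coproduct that projects onto the finitely many summands
indexed by `F`. -/
noncomputable def finProj (F : Finset I) : ∐ A ⟶ ∐ A :=
  ∑ i ∈ F, Sigma.π A i ≫ Sigma.ι A i

theorem comp_finProj {W : X} (x : W ⟶ ∐ A) (F : Finset I) :
    x ≫ finProj A F = ∑ i ∈ F, (x ≫ Sigma.π A i) ≫ Sigma.ι A i := by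
  simp [finProj, Preadditive.comp_sum]

theorem ι_finProj {F : Finset I} {i : I} (hi : i ∈ F) :
    Sigma.ι A i ≫ finProj A F = Sigma.ι A i := by
  rw [comp_finProj, Finset.sum_eq_single i]
  · rw [Sigma.ι_π_eq_id, Category.id_comp]
  · intro j _ hji
    rw [Sigma.ι_π_of_ne _ hji.symm, zero_comp]
  · exact fun h => absurd hi h

theorem finProj_comp_finProj {F F' : Finset I} (h : F ⊆ F') :
    finProj A F ≫ finProj A F' = finProj A F := by
  refine (Preadditive.sum_comp F _ (finProj A F')).trans ?_
  refine Finset.sum_congr rfl (fun i hi => ?_)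
  rw [Category.assoc, ι_finProj A (h hi)]

/-- The part of the source of `f` that is mapped into the sum of the summands indexed by `F`. -/
noncomputable def finPart {L : X} (f : L ⟶ ∐ A) (F : Finset I) : Subobject L :=
  kernelSubobject (f - f ≫ finProj A F)

theorem finPart_factors_iff {L W : X} (f : L ⟶ ∐ A) (F : Finset I) (x : W ⟶ L) :
    (finPart A f F).Factors x ↔ (x ≫ f) ≫ finProj A F = x ≫ f := by
  rw [finPart, kernelSubobject_factors_iff, Preadditive.comp_sub, sub_eq_zero, Category.assoc,
    eq_comm]

theorem finPart_mono {L : X} (f : L ⟶ ∐ A) : Monotone (finPart A f) := by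
  intro F F' h
  have hF : (finPart A f F).Factors (finPart A f F).arrow := Subobject.factors_self _
  have h1 : (finPart A f F').Factors (finPart A f F).arrow := by
    rw [finPart_factors_iff] at hF ⊢
    rw [← hF, Category.assoc, finProj_comp_finProj A h]
  exact Subobject.le_of_comm _ (Subobject.factorThru_arrow _ _ h1)

/-- By AB5, the source of a morphism to a coproduct is the directed union of its submodules which
map to finite subsums. -/
theorem iSup_finPart {L : X} (f : L ⟶ ∐ A) : ⨆ F, finPart A f F = ⊤ := by
  let S : Finset I → Subobject (∐ A) := finPart A (𝟙 _)
  have hS : ⨆ F, S F = ⊤ := by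
    have hι : ∀ i, (⨆ F, S F).Factors (Sigma.ι A i) := fun i => by
      refine Subobject.factors_of_le _ (le_iSup S {i}) ?_
      rw [finPart_factors_iff, Category.comp_id, ι_finProj A (Finset.mem_singleton_self i)]
    have : (⨆ F, S F).Factors (𝟙 _) := by
      have h1 : 𝟙 _ = Sigma.desc (fun i => (⨆ F, S F).factorThru _ (hι i)) ≫ (⨆ F, S F).arrow := by
        apply Sigma.hom_ext
        intro i
        simp
      rw [h1]
      exact Subobject.factors_comp_arrow _
    exact top_le_iff.1 (Subobject.le_of_comm
      ((⊤ : Subobject _).arrow ≫ (⨆ F, S F).factorThru _ this) (by simp))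
  have key := iSup_pullback_eq_top S (finPart_mono A _) f
    (by rw [hS]; exact Subobject.top_factors f)
  rw [eq_top_iff, ← key]
  refine iSup_mono (fun F => ?_)
  have h1 : (finPart A f F).Factors ((Subobject.pullback f).obj (S F)).arrow := by
    rw [finPart_factors_iff]
    have h2 : (S F).Factors (((Subobject.pullback f).obj (S F)).arrow ≫ f) := by
      rw [← (Subobject.isPullback f (S F)).w]
      exact Subobject.factors_comp_arrow _
    rwa [finPart_factors_iff, Category.comp_id] at h2
  exact Subobject.le_of_comm _ (Subobject.factorThru_arrow _ _ h1)

/-- In a Grothendieck category, the projections of a coproduct to the summands are jointly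
monomorphic. -/
theorem coproduct_hom_ext {L : X} {f g : L ⟶ ∐ A}
    (h : ∀ i, f ≫ Sigma.π A i = g ≫ Sigma.π A i) : f = g := by
  rw [← sub_eq_zero]
  refine eq_zero_of_iSup_eq_top _ (iSup_finPart A (f - g)) _ (fun F => ?_)
  have hF : (finPart A (f - g) F).Factors (finPart A (f - g) F).arrow := Subobject.factors_self _
  rw [finPart_factors_iff] at hF
  rw [← hF, comp_finProj]
  refine Finset.sum_eq_zero (fun i _ => ?_)
  simp [Preadditive.sub_comp, h]

theorem exists_comp_finProj_eq_of_isNoetherianObject {L : X} [IsNoetherianObject L]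
    (f : L ⟶ ∐ A) : ∃ F, f ≫ finProj A F = f := by
  obtain ⟨F, hF⟩ := exists_eq_top_of_isNoetherianObject (finPart A f) (finPart_mono A f)
    (iSup_finPart A f)
  refine ⟨F, ?_⟩
  have h : (finPart A f F).Factors (𝟙 L) := by rw [hF]; exact Subobject.top_factors _
  simpa using (finPart_factors_iff A f F _).1 h

theorem IsTorsionFree.coproduct {P : ObjectProperty X} (hA : ∀ i, IsTorsionFree P (A i)) :
    IsTorsionFree P (∐ A) := fun N f hN => coproduct_hom_ext A (fun i => by
  rw [zero_comp]; exact hA i _ hN)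

/-- A critical module is small with respect to coproducts of torsion-free modules: if `f ≠ 0`,
then the submodule mapping into a large finite subsum is nonzero, and a morphism that vanishes
on a nonzero submodule of a critical module has an image in `P`. -/
theorem IsCriticalModulo.exists_comp_finProj_eq {P : ObjectProperty X}
    (hA : ∀ i, IsTorsionFree P (A i)) {E : X} (hE : IsCriticalModulo P E) (f : E ⟶ ∐ A) :
    ∃ F, f ≫ finProj A F = f := by
  by_cases hE0 : ∀ F, (finPart A f F).arrow = 0
  · refine ⟨∅, ?_⟩
    have : f = 0 := eq_zero_of_iSup_eq_top _ (iSup_finPart A f) f (fun F => by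
      rw [hE0, zero_comp])
    rw [this, zero_comp]
  · push Not at hE0
    obtain ⟨F, hF⟩ := hE0
    refine ⟨F, ?_⟩
    by_contra hne
    have hne' : f - f ≫ finProj A F ≠ 0 := fun h => hne (sub_eq_zero.1 h).symm
    have := hE.mono_of_ne_zero (IsTorsionFree.coproduct A hA) _ hne'
    refine hF ((Preadditive.mono_iff_cancel_zero _).1 this _ _ ?_)
    exact kernelSubobject_arrow_comp _

/-- In a locally noetherian space, coproducts of injectives are injective. In an injective hull
`J` of the coproduct, a morphism `g` from a noetherian module agrees, on the inverse image of the
coproduct, with a morphism that factors through the coproduct, and the image of the difference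
meets the coproduct trivially. -/
theorem injective_coproduct (hX : IsLocallyNoetherian X) (hA : ∀ i, Injective (A i)) :
    Injective (∐ A) := by
  obtain ⟨J, i, hi⟩ := exists_isInjectiveHull (∐ A)
  have := hi.mono
  obtain ⟨ι, G, hG, hsep⟩ := hX
  have hzero : cokernel.π i = 0 := by
    refine hsep _ _ ?_
    rintro _ ⟨k⟩ g
    rw [comp_zero]
    have := hG k
    let N := kernel (g ≫ cokernel.π i)
    let n : N ⟶ G k := kernel.ι _
    have hNn : IsNoetherianObject N := isNoetherianObject_of_mono n
    have hn : (n ≫ g) ≫ cokernel.π i = 0 := by rw [Category.assoc, kernel.condition]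
    let f : N ⟶ ∐ A := Abelian.monoLift i (n ≫ g) hn
    have hf : f ≫ i = n ≫ g := Abelian.monoLift_comp _ _ _
    obtain ⟨F, hF⟩ := exists_comp_finProj_eq_of_isNoetherianObject A f
    let h : G k ⟶ ∐ A := ∑ j ∈ F, Injective.factorThru (f ≫ Sigma.π A j) n ≫ Sigma.ι A j
    have hh : n ≫ h = f := by
      rw [← hF, comp_finProj, Preadditive.comp_sum]
      refine Finset.sum_congr rfl (fun j _ => ?_)
      rw [← Category.assoc, Injective.comp_factorThru]
    let d : G k ⟶ J := g - h ≫ i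
    have hd : n ≫ d = 0 := by
      rw [Preadditive.comp_sub, ← Category.assoc, hh, hf, sub_self]
    have hdπ : d ≫ cokernel.π i = g ≫ cokernel.π i := by
      simp [d, Preadditive.sub_comp]
    suffices d = 0 by rw [← hdπ, this, zero_comp]
    have hmono : Mono (i ≫ cokernel.π d) := by
      rw [Preadditive.mono_iff_cancel_zero]
      intro W x hx
      -- lift `x`, which maps into the image of `d`, to the source of `d`
      have hx' : (x ≫ i) ≫ cokernel.π d = 0 := by rw [Category.assoc, hx]
      obtain ⟨y, hy⟩ : ∃ y : W ⟶ Abelian.image d, y ≫ Abelian.image.ι d = x ≫ i :=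
        ⟨kernel.lift (cokernel.π d) _ hx', kernel.lift_ι _ _ _⟩
      let p := pullback.fst y (Abelian.factorThruImage d)
      let t := pullback.snd y (Abelian.factorThruImage d)
      have hpt : p ≫ x ≫ i = t ≫ d := by
        rw [← hy, ← Category.assoc, pullback.condition, Category.assoc, Abelian.image.fac]
      have ht : t ≫ g ≫ cokernel.π i = 0 := by
        rw [← hdπ, ← Category.assoc, ← hpt]
        simp
      have ht2 : t ≫ d = 0 := by
        rw [← kernel.lift_ι (g ≫ cokernel.π i) t ht, Category.assoc]
        exact (congrArg _ hd).trans comp_zero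
      rw [← cancel_epi p, ← cancel_mono i, Category.assoc, hpt, ht2]
      simp
    have := hi.essential _ hmono
    rw [← cancel_mono (cokernel.π d), cokernel.condition, zero_comp]
  have hepi : Epi i := Abelian.epi_of_cokernel_π_eq_zero i hzero
  have : IsIso i := isIso_of_mono_of_epi i
  exact Injective.of_iso (asIso i).symm hi.injective

end Coproducts

end

/-! ### Direct sums of copies of an injective critical module, modulo a Serre class -/

section

variable {X : Type u} [Category.{v} X] [Abelian X] [IsGrothendieckAbelian.{v} X]

/-- The decidability instance is an implicit argument here, so that the lemma can be used for
rewriting whichever instance occurs. -/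
theorem ι_π_self {I : Type v} {inst : DecidableEq I} (A : I → X) (i : I) :
    Sigma.ι A i ≫ Sigma.π A i = 𝟙 _ := Sigma.ι_π_eq_id _ _

/-- As in `ι_π_self`, the decidability instance is an implicit argument. -/
theorem ι_π_ne {I : Type v} {inst : DecidableEq I} (A : I → X) {i j : I} (h : i ≠ j) :
    Sigma.ι A i ≫ Sigma.π A j = 0 := Sigma.ι_π_of_ne _ h

section Supports

open scoped Classical

variable {I : Type v} (A : I → X)

theorem finProj_π_of_notMem {F : Finset I} {i : I} (hi : i ∉ F) :
    finProj A F ≫ Sigma.π A i = 0 := by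
  rw [finProj, Preadditive.sum_comp]
  refine Finset.sum_eq_zero (fun j hj => ?_)
  have hji : j ≠ i := fun h => hi (h ▸ hj)
  rw [Category.assoc, Sigma.ι_π_of_ne _ hji, comp_zero]

/-- A morphism to a coproduct is supported in a set `J` of indices if its components outside `J`
vanish. -/
def SupportedIn (J : Set I) {W : X} (x : W ⟶ ∐ A) : Prop :=
  ∀ i, i ∉ J → x ≫ Sigma.π A i = 0

/-- Given a quotient `q` of a coproduct, Zorn's lemma provides a set `J` of indices that is
maximal among those for which `q` restricts to a monomorphism on the summands indexed by `J`.
Chains have upper bounds because this condition only involves finite subsets of `J`. -/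
theorem exists_maximal_support {Z : X} (q : ∐ A ⟶ Z) : ∃ J : Set I,
    (∀ ⦃W : X⦄ (x : W ⟶ ∐ A), SupportedIn A J x → x ≫ q = 0 → x = 0) ∧
    ∀ j, j ∉ J → ∃ (W : X) (x : W ⟶ ∐ A), SupportedIn A (insert j J) x ∧ x ≫ q = 0 ∧
      x ≫ Sigma.π A j ≠ 0 := by
  obtain ⟨J, hJ⟩ := zorn_subset
    {J : Set I | ∀ ⦃W : X⦄ (x : W ⟶ ∐ A), SupportedIn A J x → x ≫ q = 0 → x = 0} (by
      intro c hc hchain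
      by_cases hne : c.Nonempty
      · refine ⟨⋃₀ c, fun W x hx hxq => ?_, fun s hs => Set.subset_sUnion_of_mem hs⟩
        refine eq_zero_of_iSup_eq_top _ (iSup_finPart A x) _ (fun F => ?_)
        have hF : (finPart A x F).Factors (finPart A x F).arrow := Subobject.factors_self _
        rw [finPart_factors_iff] at hF
        obtain ⟨s, hs, hFs⟩ := hchain.directedOn.exists_mem_subset_of_finite_of_subset_sUnion hne
          (s := ↑F ∩ ⋃₀ c) (F.finite_toSet.inter_of_left _) Set.inter_subset_right
        refine hc hs _ (fun i hi => ?_) (by rw [Category.assoc, hxq, comp_zero])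
        by_cases hiF : i ∈ F
        · rw [Category.assoc, hx i (fun h => hi (hFs ⟨hiF, h⟩)), comp_zero]
        · rw [← hF, Category.assoc, finProj_π_of_notMem A hiF, comp_zero]
      · refine ⟨∅, fun W x hx _ => ?_, fun s hs => absurd ⟨s, hs⟩ hne⟩
        refine coproduct_hom_ext A (fun i => ?_)
        rw [hx i (Set.notMem_empty i), zero_comp])
  refine ⟨J, hJ.prop, fun j hj => ?_⟩
  by_contra hcon
  push Not at hcon
  have : insert j J ⊆ J := hJ.2 (fun W x hx hxq => by
    refine hJ.prop x (fun i hi => ?_) hxq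
    by_cases hij : i = j
    · subst hij
      exact hcon W x hx hxq
    · exact hx i (by simp [hij, hi])) (Set.subset_insert _ _)
  exact hj (this (Set.mem_insert _ _))

/-- The inclusion of a subsum. -/
noncomputable def inclSubsum (J : Set I) : ∐ (fun j : J => A j) ⟶ ∐ A :=
  Sigma.desc (fun j => Sigma.ι A j)

/-- The projection onto a subsum. -/
noncomputable def projSubsum (J : Set I) : ∐ A ⟶ ∐ (fun j : J => A j) :=
  Sigma.desc (fun i => if h : i ∈ J then Sigma.ι (fun j : J => A j) ⟨i, h⟩ else 0)

theorem ι_projSubsum_of_mem (J : Set I) {i : I} (hi : i ∈ J) :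
    Sigma.ι A i ≫ projSubsum A J = Sigma.ι (fun j : J => A j) ⟨i, hi⟩ := by
  simp [projSubsum, hi]

theorem ι_projSubsum_of_notMem (J : Set I) {i : I} (hi : i ∉ J) :
    Sigma.ι A i ≫ projSubsum A J = 0 := by
  simp [projSubsum, hi]

theorem inclSubsum_projSubsum (J : Set I) : inclSubsum A J ≫ projSubsum A J = 𝟙 _ := by
  apply Sigma.hom_ext
  intro j
  simp [inclSubsum, ι_projSubsum_of_mem A J j.2]

instance (J : Set I) : Mono (inclSubsum A J) := mono_of_mono_fac (inclSubsum_projSubsum A J)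

instance (J : Set I) : Epi (projSubsum A J) := epi_of_epi_fac (inclSubsum_projSubsum A J)

theorem projSubsum_π (J : Set I) [DecidableEq J] (j : J) :
    projSubsum A J ≫ Sigma.π (fun j : J => A j) j = Sigma.π A j := by
  apply Sigma.hom_ext
  intro i
  by_cases hi : i ∈ J
  · rw [← Category.assoc, ι_projSubsum_of_mem A J hi]
    by_cases hij : (⟨i, hi⟩ : J) = j
    · subst hij
      rw [Sigma.ι_π_eq_id, Sigma.ι_π_eq_id]
    · rw [Sigma.ι_π_of_ne _ hij, Sigma.ι_π_of_ne _ (fun h => hij (Subtype.ext h))]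
  · rw [← Category.assoc, ι_projSubsum_of_notMem A J hi, zero_comp, Sigma.ι_π_of_ne _ (fun h => ?_)]
    exact hi (h ▸ j.2)

theorem supportedIn_comp_inclSubsum (J : Set I) {W : X} (y : W ⟶ ∐ (fun j : J => A j)) :
    SupportedIn A J (y ≫ inclSubsum A J) := by
  intro i hi
  have : inclSubsum A J ≫ Sigma.π A i = 0 := by
    apply Sigma.hom_ext
    intro j
    simp only [inclSubsum, colimit.ι_desc_assoc, Cofan.mk_ι_app, comp_zero]
    exact Sigma.ι_π_of_ne _ (fun h => hi (h ▸ j.2))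
  rw [Category.assoc, this, comp_zero]

theorem SupportedIn.comp_projSubsum_inclSubsum {J : Set I} {W : X} {x : W ⟶ ∐ A}
    (hx : SupportedIn A J x) : (x ≫ projSubsum A J) ≫ inclSubsum A J = x := by
  refine coproduct_hom_ext A (fun i => ?_)
  by_cases hi : i ∈ J
  · have h1 : inclSubsum A J ≫ Sigma.π A i = Sigma.π (fun j : J => A j) ⟨i, hi⟩ := by
      rw [← projSubsum_π A J ⟨i, hi⟩, ← Category.assoc, inclSubsum_projSubsum, Category.id_comp]
    rw [Category.assoc, h1, Category.assoc, projSubsum_π]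
  · rw [supportedIn_comp_inclSubsum A J _ i hi, hx i hi]

theorem supportedIn_compl_iff (J : Set I) {W : X} (x : W ⟶ ∐ A) :
    SupportedIn A J x ↔ x ≫ projSubsum A Jᶜ = 0 := by
  refine ⟨fun hx => coproduct_hom_ext _ (fun i => ?_), fun hx i hi => ?_⟩
  · rw [Category.assoc, projSubsum_π, hx i i.2, zero_comp]
  · rw [← projSubsum_π A Jᶜ ⟨i, hi⟩, ← Category.assoc, hx, zero_comp]

end Supports

/-- `N` becomes isomorphic to a direct sum of copies of `E` in the quotient category by `P`. -/
def IsSumModulo (P : ObjectProperty X) [P.IsSerreClass] (E : X) : ObjectProperty X :=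
  fun N => ∃ I : Type v,
    Nonempty (P.isoModSerre.Q.obj N ≅ P.isoModSerre.Q.obj (∐ fun _ : I => E))

section Closure

variable {P : ObjectProperty X} [P.IsSerreClass] {E : X}

theorem isSumModulo_iff_of_isoModSerre {M N : X} (s : M ⟶ N) (hs : P.isoModSerre s) :
    IsSumModulo P E M ↔ IsSumModulo P E N := by
  have := Localization.inverts P.isoModSerre.Q P.isoModSerre s hs
  let e := asIso (P.isoModSerre.Q.map s)
  exact ⟨fun ⟨I, ⟨f⟩⟩ => ⟨I, ⟨e.symm ≪≫ f⟩⟩, fun ⟨I, ⟨f⟩⟩ => ⟨I, ⟨e ≪≫ f⟩⟩⟩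

theorem isSumModulo_of_iso {N : X} {I : Type v} (e : N ≅ ∐ fun _ : I => E) :
    IsSumModulo P E N := ⟨I, ⟨P.isoModSerre.Q.mapIso e⟩⟩

theorem isSumModulo_of_prop {N : X} (hN : P N) : IsSumModulo P E N := by
  have h0 : IsSumModulo P E (∐ fun _ : PEmpty.{v + 1} => E) := isSumModulo_of_iso (Iso.refl _)
  have h1 : P (∐ fun _ : PEmpty.{v + 1} => E) := P.prop_of_isZero (by
    rw [IsZero.iff_id_eq_zero]
    exact Sigma.hom_ext _ _ (fun i => i.elim))
  exact (isSumModulo_iff_of_isoModSerre (0 : N ⟶ _) (by simp [hN, h1])).2 h0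

theorem isSumModulo_self : IsSumModulo P E E :=
  isSumModulo_of_iso (coproductUniqueIso (fun _ : PUnit.{v + 1} => E)).symm

theorem isSumModulo_of_mono {K : X} (hE : IsCriticalModulo P E) (f : K ⟶ E) [Mono f]
    (hf : f ≠ 0) : IsSumModulo P E K :=
  (isSumModulo_iff_of_isoModSerre f (P.isoModSerre_of_mono f (hE.2 f hf))).2 isSumModulo_self

instance : (IsSumModulo P E).IsClosedUnderIsomorphisms where
  of_iso e := by
    rintro ⟨I, ⟨f⟩⟩
    exact ⟨I, ⟨P.isoModSerre.Q.mapIso e.symm ≪≫ f⟩⟩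

theorem IsSumModulo.exists_isoModSerre (hX : IsLocallyNoetherian X) (hEi : Injective E)
    (hE : IsCriticalModulo P E) {N : X} (hN : IsSumModulo P E N) :
    ∃ (I : Type v) (f : N ⟶ ∐ fun _ : I => E), P.isoModSerre f := by
  obtain ⟨I, ⟨e⟩⟩ := hN
  have h1 : IsTorsionFree P (∐ fun _ : I => E) :=
    IsTorsionFree.coproduct _ (fun _ => hE.isTorsionFree)
  obtain ⟨f, hf⟩ := (h1.map_bijective (injective_coproduct _ hX (fun _ => hEi)) N).2 e.hom
  refine ⟨I, f, ?_⟩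
  rw [← ObjectProperty.SerreClassLocalization.isIso_map_iff P.isoModSerre.Q P]
  dsimp only at hf
  rw [hf]
  infer_instance

theorem prop_of_epi_coproduct (hP : ∀ J : Type v, P.IsClosedUnderColimitsOfShape (Discrete J))
    {I : Type v} {A : I → X} {T : X} (t : ∐ A ⟶ T) [Epi t]
    (h : ∀ i, ∃ (B : X) (e : A i ⟶ B) (b : B ⟶ T), P B ∧ e ≫ b = Sigma.ι A i ≫ t) : P T := by
  choose B e b hB hb using h
  have h1 : Limits.Sigma.map e ≫ Sigma.desc b = t := by
    apply Sigma.hom_ext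
    intro i
    simp [hb]
  have : Epi (Sigma.desc b) := epi_of_epi_fac h1
  have := hP I
  exact P.prop_of_epi (Sigma.desc b) (P.prop_colimit (Discrete.functor B) (fun ⟨i⟩ => hB i))

/-- If each nonzero component of `t` vanishes on some nonzero submodule of the critical module `E`,
then `t` factors through a sum of proper quotients of `E`. -/
theorem IsCriticalModulo.prop_of_epi_coproduct
    (hP : ∀ J : Type v, P.IsClosedUnderColimitsOfShape (Discrete J))
    (hE : IsCriticalModulo P E) {I : Type v} {T : X} (t : (∐ fun _ : I => E) ⟶ T) [Epi t]
    (h : ∀ i, Sigma.ι (fun _ : I => E) i ≫ t = 0 ∨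
      ∃ (W : X) (x : W ⟶ E), x ≠ 0 ∧ x ≫ Sigma.ι (fun _ : I => E) i ≫ t = 0) : P T := by
  refine NCSpace.prop_of_epi_coproduct hP t (fun i => ?_)
  rcases h i with h0 | ⟨W, x, hx, h0⟩
  · exact ⟨0, 0, 0, P.prop_zero, by rw [h0, zero_comp]⟩
  · exact ⟨cokernel x, cokernel.π x, cokernel.desc x _ h0, hE.2 x hx, cokernel.π_desc _ _ _⟩

/-- A quotient of a direct sum of copies of `E` is, modulo `P`, the sum over a subset of indices. -/
theorem isSumModulo_of_epi_coproduct
    (hP : ∀ J : Type v, P.IsClosedUnderColimitsOfShape (Discrete J))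
    (hE : IsCriticalModulo P E) {I : Type v} {Z : X} (q : (∐ fun _ : I => E) ⟶ Z) [Epi q] :
    IsSumModulo P E Z := by
  classical
  let A : I → X := fun _ => E
  obtain ⟨J, hJ1, hJ2⟩ := exists_maximal_support A q
  let s := inclSubsum A J ≫ q
  have hs : Mono s := by
    rw [Preadditive.mono_iff_cancel_zero]
    intro W y hy
    rw [← cancel_mono (inclSubsum A J), zero_comp]
    exact hJ1 _ (supportedIn_comp_inclSubsum A J y) (by simpa [s] using hy)
  have hcok : P (cokernel s) := by
    have h1 : ∀ {W : X} (x : W ⟶ ∐ A), SupportedIn A J x → x ≫ q ≫ cokernel.π s = 0 := by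
      intro W x hx
      rw [← hx.comp_projSubsum_inclSubsum, Category.assoc, ← Category.assoc (inclSubsum A J)]
      simp [s]
    refine hE.prop_of_epi_coproduct hP (q ≫ cokernel.π s) (fun i => ?_)
    by_cases hi : i ∈ J
    · left
      exact h1 _ (fun k hk => Sigma.ι_π_of_ne _ (fun h => hk (h ▸ hi)))
    · right
      obtain ⟨W, x, hx, hxq, hx0⟩ := hJ2 i hi
      refine ⟨W, x ≫ Sigma.π A i, hx0, ?_⟩
      have h2 : SupportedIn A J (x - (x ≫ Sigma.π A i) ≫ Sigma.ι A i) := by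
        intro k hk
        rw [Preadditive.sub_comp, Category.assoc (x ≫ _)]
        by_cases hki : i = k
        · subst hki
          rw [Sigma.ι_π_eq_id, Category.comp_id, sub_self]
        · rw [Sigma.ι_π_of_ne _ hki, comp_zero, sub_zero]
          exact hx k (by simp [hk, Ne.symm hki])
      have h3 := h1 _ h2
      rw [Preadditive.sub_comp, ← Category.assoc x, hxq, zero_comp, zero_sub, neg_eq_zero] at h3
      rw [← Category.assoc]
      exact h3
  exact (isSumModulo_iff_of_isoModSerre s (P.isoModSerre_of_mono s hcok)).1
    (isSumModulo_of_iso (Iso.refl _))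

/-- A submodule of a direct sum of copies of `E` is, modulo `P`, the sum over a subset of
indices: a subsum that is maximal among those meeting `L` trivially has a complement with this
property. -/
theorem isSumModulo_of_mono_coproduct
    (hP : ∀ J : Type v, P.IsClosedUnderColimitsOfShape (Discrete J))
    (hE : IsCriticalModulo P E) {I : Type v} {L : X} (l : L ⟶ ∐ fun _ : I => E) [Mono l] :
    IsSumModulo P E L := by
  classical
  let A : I → X := fun _ => E
  obtain ⟨J, hJ1, hJ2⟩ := exists_maximal_support A (cokernel.π l)
  let s := l ≫ projSubsum A Jᶜ
  have hs : Mono s := by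
    rw [Preadditive.mono_iff_cancel_zero]
    intro W y hy
    rw [← cancel_mono l, zero_comp]
    refine hJ1 _ ((supportedIn_compl_iff A J _).2 (by simpa [s] using hy)) (by simp)
  have hcok : P (cokernel s) := by
    refine hE.prop_of_epi_coproduct hP (I := (Jᶜ : Set I)) (cokernel.π s) (fun i => ?_)
    right
    obtain ⟨W, x, hx, hxq, hx0⟩ := hJ2 i i.2
    refine ⟨W, x ≫ Sigma.π A i, hx0, ?_⟩
    have h1 : x ≫ projSubsum A Jᶜ =
        (x ≫ Sigma.π A i) ≫ Sigma.ι (fun j : (Jᶜ : Set I) => A j) i := by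
      refine coproduct_hom_ext _ (fun k => ?_)
      rw [Category.assoc, projSubsum_π, Category.assoc (x ≫ _)]
      by_cases hki : i = k
      · subst hki
        rw [ι_π_self, Category.comp_id]
      · rw [ι_π_ne _ hki, comp_zero]
        refine hx k (fun h => ?_)
        rcases Set.mem_insert_iff.1 h with h | h
        · exact hki (Subtype.ext h.symm)
        · exact k.2 h
    have h2 : Abelian.monoLift l x hxq ≫ s = x ≫ projSubsum A Jᶜ := by
      rw [← Category.assoc, Abelian.monoLift_comp]
    rw [← Category.assoc]
    refine (congrArg (· ≫ cokernel.π s) (h2.trans h1).symm).trans ?_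
    simp
  exact (isSumModulo_iff_of_isoModSerre s (P.isoModSerre_of_mono s hcok)).2
    (isSumModulo_of_iso (Iso.refl _))

/-- Coproducts are exact, so a coproduct of isomorphisms modulo `P` is one. -/
theorem isoModSerre_colimMap
    (hP : ∀ J : Type v, P.IsClosedUnderColimitsOfShape (Discrete J)) {J : Type v}
    {F G : Discrete J ⥤ X} (φ : F ⟶ G)
    (h : ∀ j, P.isoModSerre (φ.app j)) : P.isoModSerre (colim.map φ) := by
  have := hP J
  constructor
  · refine P.prop_of_iso (PreservesKernel.iso colim φ) (P.prop_colimit _ (fun j => ?_))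
    exact P.prop_of_iso (PreservesKernel.iso ((evaluation _ _).obj j) φ).symm (h j).1
  · refine P.prop_of_iso (PreservesCokernel.iso colim φ) (P.prop_colimit _ (fun j => ?_))
    exact P.prop_of_iso (PreservesCokernel.iso ((evaluation _ _).obj j) φ).symm (h j).2

omit [IsGrothendieckAbelian.{v} X] in
/-- An extension whose left term is isomorphic to `Y` modulo `P` splits modulo `P` if the
isomorphism extends to the middle term. -/
theorem isoModSerre_biprodLift {S : ShortComplex X} (hS : S.ShortExact) {Y : X} (f : S.X₁ ⟶ Y)
    (hf : P.isoModSerre f) (r : S.X₂ ⟶ Y) (hr : S.f ≫ r = f) :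
    P.isoModSerre (biprod.lift r S.g) := by
  have := hS.mono_f
  have := hS.epi_g
  obtain ⟨a, ha⟩ : ∃ a, a = biprod.lift r S.g := ⟨_, rfl⟩
  have ha1 : a ≫ biprod.fst = r := by rw [ha, biprod.lift_fst]
  have ha2 : a ≫ biprod.snd = S.g := by rw [ha, biprod.lift_snd]
  rw [← ha]
  constructor
  · have hk : kernel.ι a ≫ S.g = 0 := by rw [← ha2, kernel.condition_assoc, zero_comp]
    obtain ⟨k, hk⟩ : ∃ k, k ≫ S.f = kernel.ι a := ⟨hS.exact.lift _ hk, hS.exact.lift_f _ hk⟩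
    have hkf : k ≫ f = 0 := by
      rw [← hr, ← Category.assoc, hk, ← ha1, kernel.condition_assoc, zero_comp]
    have : Mono k := mono_of_mono_fac hk
    have : Mono (kernel.lift f k hkf) := mono_of_mono_fac (kernel.lift_ι f k hkf)
    exact P.prop_of_mono (kernel.lift f k hkf) hf.1
  · have h1 : f ≫ biprod.inl ≫ cokernel.π a = 0 := by
      have : S.f ≫ a = f ≫ biprod.inl := by
        apply biprod.hom_ext
        · simp [ha1, hr]
        · simp [ha2]
      rw [← Category.assoc, ← this, Category.assoc, cokernel.condition, comp_zero]
    have h2 : S.g ≫ biprod.inr ≫ cokernel.π a = - (r ≫ biprod.inl ≫ cokernel.π a) := by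
      have h3 : a = r ≫ biprod.inl + S.g ≫ biprod.inr := by
        apply biprod.hom_ext <;> simp [ha1, ha2]
      have h4 : (r ≫ biprod.inl + S.g ≫ biprod.inr) ≫ cokernel.π a = 0 := by
        rw [← h3, cokernel.condition]
      rw [Preadditive.add_comp, Category.assoc, Category.assoc] at h4
      exact eq_neg_of_add_eq_zero_right h4
    have : Epi (cokernel.desc f _ h1) := by
      rw [Preadditive.epi_iff_cancel_zero]
      intro T z hz
      have h5 : biprod.inl ≫ cokernel.π a ≫ z = 0 := by
        have : cokernel.π f ≫ cokernel.desc f _ h1 ≫ z = 0 := by rw [hz, comp_zero]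
        simpa using this
      have h6 : biprod.inr ≫ cokernel.π a ≫ z = 0 := by
        rw [← cancel_epi S.g, comp_zero]
        have := congrArg (· ≫ z) h2
        simpa only [Category.assoc, Preadditive.neg_comp, h5, comp_zero, neg_zero] using this
      rw [← cancel_epi (cokernel.π a), comp_zero]
      exact biprod.hom_ext' _ _ (by simpa using h5) (by simpa using h6)
    exact P.prop_of_epi (cokernel.desc f _ h1) hf.2

omit [IsGrothendieckAbelian.{v} X] in
theorem isoModSerre_biprodMap_id (Y : X) {A B : X} (f : A ⟶ B) (hf : P.isoModSerre f) :
    P.isoModSerre (biprod.map (𝟙 Y) f) := by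
  obtain ⟨b, hb⟩ : ∃ b, b = biprod.map (𝟙 Y) f := ⟨_, rfl⟩
  rw [← hb]
  constructor
  · have h1 : kernel.ι b ≫ biprod.fst = 0 := by
      have h : b ≫ biprod.fst = biprod.fst := by simp [hb]
      rw [← h, kernel.condition_assoc, zero_comp]
    have h2 : (kernel.ι b ≫ biprod.snd) ≫ f = 0 := by
      have h : b ≫ biprod.snd = biprod.snd ≫ f := by simp [hb]
      rw [Category.assoc, ← h, kernel.condition_assoc, zero_comp]
    have : Mono (kernel.lift f _ h2) := by
      rw [Preadditive.mono_iff_cancel_zero]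
      intro W y hy
      rw [← cancel_mono (kernel.ι b), zero_comp]
      apply biprod.hom_ext
      · rw [Category.assoc, h1, comp_zero, zero_comp]
      · have : y ≫ kernel.lift f _ h2 ≫ kernel.ι f = 0 := by
          rw [← Category.assoc, hy, zero_comp]
        simpa using this
    exact P.prop_of_mono (kernel.lift f _ h2) hf.1
  · have h1 : biprod.inl ≫ cokernel.π b = 0 := by
      have h : biprod.inl ≫ b = biprod.inl := by simp [hb]
      rw [← h, Category.assoc, cokernel.condition, comp_zero]
    have h2 : f ≫ biprod.inr ≫ cokernel.π b = 0 := by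
      have h : biprod.inr ≫ b = f ≫ biprod.inr := by simp [hb]
      rw [← Category.assoc, ← h, Category.assoc, cokernel.condition, comp_zero]
    have : Epi (cokernel.desc f _ h2) := by
      rw [Preadditive.epi_iff_cancel_zero]
      intro T z hz
      rw [← cancel_epi (cokernel.π b), comp_zero]
      apply biprod.hom_ext'
      · rw [← Category.assoc, h1, zero_comp, comp_zero]
      · have : cokernel.π f ≫ cokernel.desc f _ h2 ≫ z = 0 := by rw [hz, comp_zero]
        simpa using this
    exact P.prop_of_epi (cokernel.desc f _ h2) hf.2

section

variable (hX : IsLocallyNoetherian X)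
  (hP : ∀ J : Type v, P.IsClosedUnderColimitsOfShape (Discrete J))
  (hEi : Injective E) (hE : IsCriticalModulo P E)

include hX hP hEi hE

theorem isClosedUnderQuotients_isSumModulo : (IsSumModulo P E).IsClosedUnderQuotients where
  prop_of_epi {N N'} g _ hN := by
    obtain ⟨I, f, hf⟩ := hN.exists_isoModSerre hX hEi hE
    refine (isSumModulo_iff_of_isoModSerre (pushout.inr f g)
      (P.isoModSerre.pushout_inr f g hf)).2 ?_
    exact isSumModulo_of_epi_coproduct hP hE (pushout.inl f g)

theorem isClosedUnderSubobjects_isSumModulo : (IsSumModulo P E).IsClosedUnderSubobjects where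
  prop_of_mono {N' N} m _ hN := by
    obtain ⟨I, f, hf⟩ := hN.exists_isoModSerre hX hEi hE
    have h1 : P.monoModSerre (m ≫ f) :=
      P.monoModSerre.comp_mem _ _ (P.monoModSerre_of_mono m) hf.1
    refine (isSumModulo_iff_of_isoModSerre _ h1.isoModSerre_factorThruImage).2 ?_
    exact isSumModulo_of_mono_coproduct hP hE (Abelian.image.ι (m ≫ f))

theorem isClosedUnderColimitsOfShape_isSumModulo (J : Type v) :
    (IsSumModulo P E).IsClosedUnderColimitsOfShape (Discrete J) := by
  refine ObjectProperty.IsClosedUnderColimitsOfShape.mk' ?_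
  rintro _ ⟨F, hF⟩
  choose I f hf using fun j : J => (hF ⟨j⟩).exists_isoModSerre hX hEi hE
  let φ : F ⟶ Discrete.functor (fun j => ∐ fun _ : I j => E) := Discrete.natTrans (fun j => f j.as)
  refine (isSumModulo_iff_of_isoModSerre (colim.map φ)
    (isoModSerre_colimMap hP φ (fun j => hf j.as))).2 ?_
  exact isSumModulo_of_iso (sigmaSigmaIso I (fun _ _ => E))

omit hP in
/-- The injectivity of the coproducts of copies of `E` makes extensions split modulo `P`. -/
theorem isClosedUnderExtensions_isSumModulo : (IsSumModulo P E).IsClosedUnderExtensions where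
  prop_X₂_of_shortExact {S} hS h₁ h₃ := by
    obtain ⟨I, f, hf⟩ := h₁.exists_isoModSerre hX hEi hE
    obtain ⟨I', f', hf'⟩ := h₃.exists_isoModSerre hX hEi hE
    have := hS.mono_f
    have := hS.epi_g
    have := injective_coproduct (fun _ : I => E) hX (fun _ => hEi)
    let r := Injective.factorThru f S.f
    have hr : S.f ≫ r = f := Injective.comp_factorThru _ _
    let Y := ∐ fun _ : I => E
    let Y' := ∐ fun _ : I' => E
    have ha := isoModSerre_biprodLift hS f hf r hr
    have hb := isoModSerre_biprodMap_id Y f' hf'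
    let e : Y ⊞ Y' ≅ ∐ fun _ : I ⊕ I' => E :=
      { hom := biprod.desc (Sigma.desc fun i => Sigma.ι (fun _ : I ⊕ I' => E) (Sum.inl i))
          (Sigma.desc fun i => Sigma.ι (fun _ : I ⊕ I' => E) (Sum.inr i))
        inv := Sigma.desc (fun i => Sum.rec (motive := fun _ => E ⟶ Y ⊞ Y')
          (fun i => Sigma.ι (fun _ : I => E) i ≫ biprod.inl)
          (fun i => Sigma.ι (fun _ : I' => E) i ≫ biprod.inr) i)
        hom_inv_id := by
          apply biprod.hom_ext' <;> apply Sigma.hom_ext <;> intro i <;> simp [Y, Y']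
        inv_hom_id := by
          apply Sigma.hom_ext
          rintro (i | i) <;> simp }
    exact (isSumModulo_iff_of_isoModSerre _ (P.isoModSerre.comp_mem _ _ ha hb)).2
      (isSumModulo_of_iso e)

end

end Closure

end

/-! ### Dévissage along a dimension function -/

section

variable {X : Type u} [Category.{v} X] [Abelian X]

theorem isNoetherianObject_of_epi {A B : X} (p : A ⟶ B) [Epi p] [IsNoetherianObject A] :
    IsNoetherianObject B := by
  rw [isNoetherianObject_iff_not_strictMono]
  intro f hf
  refine not_strictMono_of_isNoetherianObject (fun n => (Subobject.pullback p).obj (f n))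
    (fun m n hmn => lt_of_le_not_ge ((Subobject.pullback p).monotone (hf hmn).le) (fun h => ?_))
  refine (hf hmn).not_ge ?_
  have hπ : Epi (Subobject.pullbackπ p (f n)) :=
    (MorphismProperty.epimorphisms X).of_isPullback (Subobject.isPullback p (f n)).flip
      (inferInstanceAs (Epi p))
  have h1 : (f m).Factors (f n).arrow := by
    rw [factors_iff_comp_cokernel_eq_zero, ← cancel_epi (Subobject.pullbackπ p (f n)), comp_zero,
      ← Category.assoc, (Subobject.isPullback p (f n)).w, ← Subobject.ofLE_arrow h,
      Category.assoc (Subobject.ofLE _ _ h), ← (Subobject.isPullback p (f m)).w]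
    simp
  exact Subobject.le_of_comm _ (Subobject.factorThru_arrow _ _ h1)

/-- Dévissage for noetherian objects: a property that is closed under extensions and holds for some
nonzero subobject of every nonzero noetherian object holds for all of them. -/
theorem prop_of_isNoetherianObject (R : ObjectProperty X) [R.IsClosedUnderIsomorphisms]
    [R.IsClosedUnderExtensions] (h0 : ∀ N : X, IsZero N → R N)
    (h : ∀ N : X, IsNoetherianObject N → ¬ IsZero N →
      ∃ (K : X) (k : K ⟶ N), Mono k ∧ ¬ IsZero K ∧ R K)
    (G : X) [IsNoetherianObject G] : R G := by
  -- a maximal subobject with the property is everything, as otherwise it could be enlarged by the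
  -- preimage of a subobject of the quotient
  obtain ⟨S, hS, hmax⟩ := (wellFounded_gt (α := Subobject G)).has_min {S | R (S : X)}
    ⟨⊥, h0 _ ((isZero_zero X).of_iso Subobject.botCoeIsoZero)⟩
  have := isNoetherianObject_of_epi (cokernel.π S.arrow)
  by_cases hz : IsZero (cokernel S.arrow)
  · have : Epi S.arrow := Abelian.epi_of_cokernel_π_eq_zero _ (hz.eq_of_tgt _ _)
    have : IsIso S.arrow := isIso_of_mono_of_epi _
    exact R.prop_of_iso (asIso S.arrow) hS
  · exfalso
    obtain ⟨K, k, hk, hK, hRK⟩ := h _ inferInstance hz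
    let π := cokernel.π S.arrow
    let i : (S : X) ⟶ pullback π k := pullback.lift S.arrow 0 (by simp [π])
    have hi : i ≫ pullback.fst π k = S.arrow := pullback.lift_fst _ _ _
    have hi2 : i ≫ pullback.snd π k = 0 := pullback.lift_snd _ _ _
    have : Mono i := mono_of_mono_fac hi
    have hse : (ShortComplex.mk i (pullback.snd π k) hi2).ShortExact :=
      { exact := by
          refine ShortComplex.exact_of_f_is_kernel _ (KernelFork.IsLimit.ofι' _ _ ?_)
          intro A x hx
          have hx' : (x ≫ pullback.fst π k) ≫ cokernel.π S.arrow = 0 := by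
            rw [Category.assoc]
            change x ≫ pullback.fst π k ≫ π = 0
            rw [pullback.condition, ← Category.assoc, hx, zero_comp]
          refine ⟨Abelian.monoLift S.arrow _ hx', ?_⟩
          apply pullback.hom_ext
          · rw [Category.assoc, hi, Abelian.monoLift_comp]
          · rw [Category.assoc, hi2, comp_zero, hx] }
    have hR : R (pullback π k) := R.prop_X₂_of_shortExact hse hS hRK
    refine hmax (Subobject.mk (pullback.fst π k))
      (R.prop_of_iso (Subobject.underlyingIso _).symm hR) ?_
    refine lt_of_le_not_ge (Subobject.le_mk_of_comm i hi) (fun hle => hK ?_)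
    have h1 : S.Factors (pullback.fst π k) :=
      Subobject.factors_of_le _ hle (Subobject.mk_factors_self _)
    rw [factors_iff_comp_cokernel_eq_zero] at h1
    have h2 : pullback.snd π k ≫ k = 0 := by rw [← pullback.condition]; exact h1
    have h3 : k = 0 := by rw [← cancel_epi (pullback.snd π k), h2, comp_zero]
    exact IsZero.of_mono_eq_zero k h3

/-- A property of modules over a locally noetherian space that is closed under direct sums,
quotients and extensions holds for all modules if every nonzero noetherian module has a nonzero
submodule with the property. -/
theorem prop_of_isLocallyNoetherian [IsGrothendieckAbelian.{v} X] (hX : IsLocallyNoetherian X)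
    (R : ObjectProperty X) [R.IsClosedUnderQuotients] [R.IsClosedUnderExtensions]
    (hR : ∀ J : Type v, R.IsClosedUnderColimitsOfShape (Discrete J))
    (h0 : ∀ N : X, IsZero N → R N)
    (h : ∀ N : X, IsNoetherianObject N → ¬ IsZero N →
      ∃ (K : X) (k : K ⟶ N), Mono k ∧ ¬ IsZero K ∧ R K) (N : X) : R N := by
  obtain ⟨ι, G, hG, hsep⟩ := hX
  let I := Σ i : ι, (G i ⟶ N)
  let t : (∐ fun p : I => G p.1) ⟶ N := Sigma.desc (fun p : I => p.2)
  have : Epi t := ⟨fun a b hab => hsep _ _ (by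
    rintro _ ⟨i⟩ x
    have := congrArg (fun y => Sigma.ι (fun p : I => G p.1) ⟨i, x⟩ ≫ y) hab
    simpa [t] using this)⟩
  have := hR I
  refine R.prop_of_epi t (R.prop_colimit _ ?_)
  rintro ⟨p⟩
  have := hG p.1
  exact prop_of_isNoetherianObject R h0 h (G p.1)

namespace DimensionFunction

variable (δ : DimensionFunction.{w} X) {α : Ordinal.{w}}

/-- In a space of dimension `α`, the `α`-critical modules are the modules that are critical modulo
`C_{<α}`. -/
theorem isCritical_iff (hle : ∀ M, δ.dim M ≤ (α : WithBot Ordinal.{w})) (M : X) :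
    δ.IsCritical α M ↔ IsCriticalModulo (δ.ltSubcategory α) M := by
  have h1 : ¬ δ.ltSubcategory α M ↔ δ.dim M = (α : WithBot Ordinal.{w}) :=
    ⟨fun h => le_antisymm (hle M) (not_lt.1 h), fun h => by
      rw [ltSubcategory, h]; exact lt_irrefl _⟩
  refine ⟨fun ⟨h, h'⟩ => ⟨h1.2 h, fun N f hf => ?_⟩, fun ⟨h, h'⟩ => ⟨h1.1 h, fun N hN => ?_⟩⟩
  · refine prop_cokernel_of_epi_comp (P := δ.ltSubcategory α) (factorThruImageSubobject f) _
      (imageSubobject_arrow_comp f) (h' (imageSubobject f) (fun h0 => hf ?_))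
    have : (imageSubobject f).arrow = 0 := by rw [h0, Subobject.bot_arrow]
    rw [← imageSubobject_arrow_comp f, this, comp_zero]
  · exact h' N.arrow (fun h0 => hN (eq_bot_of_arrow_eq_zero N h0))

/-- If all nonzero submodules of a nonzero noetherian module had dimension `α` without being
critical, one could repeatedly pick a submodule with quotient of dimension `α`, against finite
partitivity. -/
theorem exists_subobject_of_isNoetherianObject
    (hle : ∀ M, δ.dim M ≤ (α : WithBot Ordinal.{w})) (N : X) (hN : IsNoetherianObject N)
    (hN0 : ¬ IsZero N) : ∃ (K : X) (k : K ⟶ N), Mono k ∧ ¬ IsZero K ∧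
      (δ.ltSubcategory α K ∨ IsCriticalModulo (δ.ltSubcategory α) K) := by
  by_contra hcon
  push Not at hcon
  let P := δ.ltSubcategory α
  have hne : ∀ {S : Subobject N}, S ≠ ⊥ → ¬ IsZero (S : X) := fun {S} hS hz =>
    hS (eq_bot_of_arrow_eq_zero S (hz.eq_of_src _ _))
  have step : ∀ S : {S : Subobject N // S ≠ ⊥}, ∃ T : {S : Subobject N // S ≠ ⊥},
      ∃ h : T.1 < S.1, ¬ P (subquotient h.le) := by
    rintro ⟨S, hS⟩
    obtain ⟨h1, h2⟩ := hcon _ S.arrow inferInstance (hne hS)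
    have h3 : ∃ (A : X) (f : A ⟶ (S : X)), f ≠ 0 ∧ ¬ P (cokernel f) := by
      by_contra h
      push Not at h
      exact h2 ⟨h1, h⟩
    obtain ⟨A, f, hf, hPf⟩ := h3
    let T := Subobject.mk (Abelian.image.ι f ≫ S.arrow)
    have hTS : T ≤ S := Subobject.mk_le_of_comm (Abelian.image.ι f) rfl
    let e : A ⟶ (T : X) := Abelian.factorThruImage f ≫ (Subobject.underlyingIso _).inv
    have he : e ≫ Subobject.ofLE T S hTS = f := by
      rw [← cancel_mono S.arrow, Category.assoc, Subobject.ofLE_arrow]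
      simp [e, T]
    have hP : ¬ P (subquotient hTS) := fun h =>
      hPf (prop_cokernel_of_epi_comp (P := δ.ltSubcategory α) e _ he h)
    refine ⟨⟨T, fun h => hf ?_⟩, lt_of_le_not_ge hTS (fun hST => hP ?_), hP⟩
    · have : T.arrow = 0 := by rw [h, Subobject.bot_arrow]
      rw [← cancel_mono S.arrow, ← he, Category.assoc, Subobject.ofLE_arrow, this, comp_zero,
        zero_comp]
    · have h4 : Subobject.ofLE S T hST ≫ Subobject.ofLE T S hTS = 𝟙 _ := by
        rw [← cancel_mono S.arrow]
        simp
      have : Epi (Subobject.ofLE T S hTS) := epi_of_epi_fac h4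
      exact ObjectProperty.prop_of_isZero (δ.ltSubcategory α) (isZero_cokernel_of_epi _)
  choose next hlt hP using step
  have htop : (⊤ : Subobject N) ≠ ⊥ := fun h => hN0 (by
    have : (⊤ : Subobject N).arrow = 0 := by rw [h, Subobject.bot_arrow]
    exact IsZero.of_epi_eq_zero _ this)
  let f : ℕ → {S : Subobject N // S ≠ ⊥} := fun n => next^[n] ⟨⊤, htop⟩
  have hf : StrictAnti (fun n => (f n).1) := strictAnti_nat_of_succ_lt (fun n => by
    have : f (n + 1) = next (f n) := Function.iterate_succ_apply' _ _ _
    rw [this]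
    exact hlt (f n))
  have hdim : δ.dim N = (α : WithBot Ordinal.{w}) :=
    le_antisymm (hle N) (not_lt.1 (hcon N (𝟙 N) inferInstance hN0).1)
  have hfin := δ.finitely_partitive N (fun n => (f n).1) hf hN rfl
  refine Set.infinite_univ (hfin.subset (fun n _ => ?_))
  have key : ∀ (T : {S : Subobject N // S ≠ ⊥}) (hT : T = next (f n)) (h : T.1 ≤ (f n).1),
      ¬ P (subquotient h) := by
    rintro _ rfl h
    exact hP (f n)
  have := key (f (n + 1)) (Function.iterate_succ_apply' _ _ _) (hf.antitone (Nat.le_succ n))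
  rw [Set.mem_ofPred_eq, hdim]
  exact this

/-- If all `α`-critical modules are in a property closed under sums, quotients and extensions that
contains `C_{<α}`, then so are all modules. -/
theorem prop_of_isCriticalModulo [IsGrothendieckAbelian.{v} X] (hX : IsLocallyNoetherian X)
    (hle : ∀ M, δ.dim M ≤ (α : WithBot Ordinal.{w}))
    (R : ObjectProperty X) [R.IsClosedUnderQuotients] [R.IsClosedUnderExtensions]
    (hR : ∀ J : Type v, R.IsClosedUnderColimitsOfShape (Discrete J))
    (h1 : ∀ N, δ.ltSubcategory α N → R N)
    (h2 : ∀ N, IsCriticalModulo (δ.ltSubcategory α) N → R N) (N : X) : R N := by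
  refine prop_of_isLocallyNoetherian hX R hR
    (fun N hN => h1 N (ObjectProperty.prop_of_isZero (δ.ltSubcategory α) hN)) (fun N hN hN0 => ?_) N
  obtain ⟨K, k, hk, hK, h⟩ := δ.exists_subobject_of_isNoetherianObject hle N hN hN0
  exact ⟨K, k, hk, hK, h.elim (h1 K) (h2 K)⟩

theorem exists_isCriticalModulo [IsGrothendieckAbelian.{v} X] (hX : IsLocallyNoetherian X)
    (hle : ∀ M, δ.dim M ≤ (α : WithBot Ordinal.{w}))
    (hloc : ∀ J : Type v, (δ.ltSubcategory α).IsClosedUnderColimitsOfShape (Discrete J))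
    {N : X} (hN : ¬ δ.ltSubcategory α N) :
    ∃ K : X, IsCriticalModulo (δ.ltSubcategory α) K := by
  by_contra h
  push Not at h
  exact hN (δ.prop_of_isCriticalModulo hX hle (δ.ltSubcategory α) hloc (fun _ h => h)
    (fun K hK => absurd hK (h K)) N)

end DimensionFunction

end

/-! ### The quotient category as a category of vector spaces -/

section

variable {X : Type u} [Category.{v} X] [Abelian X]

section EndomorphismRing

variable {P : ObjectProperty X} [P.IsSerreClass] {E : X}

theorem IsCriticalModulo.nontrivial_end (hE : IsCriticalModulo P E) : Nontrivial (End E) :=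
  ⟨𝟙 E, 0, fun h => hE.not_isZero ((IsZero.iff_id_eq_zero E).2 h)⟩

theorem IsCriticalModulo.isUnit_or_eq_zero (hE : IsCriticalModulo P E) (hEi : Injective E)
    (f : End E) : IsUnit f ∨ f = 0 := by
  by_cases hf : f = 0
  · exact Or.inr hf
  · exact Or.inl ((isUnit_iff_isIso f).2 (hE.isIso_of_ne_zero hEi f hf))

/-- The endomorphism ring of an injective critical module is a division ring, by Schur's lemma. -/
noncomputable abbrev IsCriticalModulo.divisionRingEnd (hE : IsCriticalModulo P E)
    (hEi : Injective E) : DivisionRing (End E) :=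
  have := hE.nontrivial_end
  DivisionRing.ofIsUnitOrEqZero (hE.isUnit_or_eq_zero hEi)

/-- The Jacobson radical of the endomorphism ring of an injective critical module vanishes. -/
theorem IsCriticalModulo.nonempty_end_ringEquiv_residueRing (hE : IsCriticalModulo P E)
    (hEi : Injective E) : Nonempty (End E ≃+* residueRing E) := by
  have := hE.nontrivial_end
  have h : Ring.jacobson (End E) = ⊥ := by
    let _ := hE.divisionRingEnd hEi
    exact IsSemisimpleRing.jacobson_eq_bot (End E)
  exact ⟨((Ideal.quotEquivOfEq h).trans (RingEquiv.quotientBot _)).symm⟩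

end EndomorphismRing

section Equivalence

variable [IsGrothendieckAbelian.{v} X] (P : ObjectProperty X) [P.IsSerreClass] (E : X)

/-- The full subcategory of `X` on the direct sums of copies of `E`, with objects the index sets. -/
abbrev SumsOfCopies (E : X) :=
  InducedCategory X (fun I : Type v => ∐ fun _ : I => E)

/-- The functor from direct sums of copies of `E` to the quotient category. -/
noncomputable abbrev sumsToQuotient : SumsOfCopies E ⥤ P.isoModSerre.Localization :=
  inducedFunctor _ ⋙ P.isoModSerre.Q

/-- The functor `Hom(E, -)` from direct sums of copies of `E` to right modules over `End(E)`. -/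
noncomputable abbrev sumsToModule : SumsOfCopies E ⥤ ModuleCat.{v} (End E)ᵐᵒᵖ :=
  inducedFunctor _ ⋙ preadditiveCoyonedaObj E

variable {P E} (hX : IsLocallyNoetherian X) (hEi : Injective E) (hE : IsCriticalModulo P E)

include hX hEi hE

theorem isEquivalence_sumsToQuotient (htop : ∀ N, IsSumModulo P E N) :
    (sumsToQuotient P E).IsEquivalence where
  faithful := ⟨fun {I J f g} h => by
    have h1 : IsTorsionFree P (∐ fun _ : J => E) :=
      IsTorsionFree.coproduct _ (fun _ => hE.isTorsionFree)
    apply InducedCategory.Hom.ext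
    exact (h1.map_bijective (injective_coproduct _ hX (fun _ => hEi)) _).1 h⟩
  full := ⟨fun {I J} g => by
    have h1 : IsTorsionFree P (∐ fun _ : J => E) :=
      IsTorsionFree.coproduct _ (fun _ => hE.isTorsionFree)
    obtain ⟨f, hf⟩ := (h1.map_bijective (injective_coproduct _ hX (fun _ => hEi)) _).2 g
    exact ⟨⟨f⟩, hf⟩⟩
  essSurj := ⟨fun Z => by
    have := Localization.essSurj P.isoModSerre.Q P.isoModSerre
    obtain ⟨I, ⟨e⟩⟩ := htop (P.isoModSerre.Q.objPreimage Z)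
    exact ⟨I, ⟨e.symm ≪≫ P.isoModSerre.Q.objObjPreimageIso Z⟩⟩⟩

omit hX hEi in
/-- The inclusions of the summands generate `Hom(E, ∐ E)`, since `E` is small with respect to such
coproducts. -/
theorem span_range_ι (I : Type v) :
    Submodule.span (End E)ᵐᵒᵖ (Set.range (Sigma.ι (fun _ : I => E))) = ⊤ := by
  classical
  rw [eq_top_iff]
  rintro x -
  obtain ⟨F, hF⟩ := hE.exists_comp_finProj_eq _ (fun _ : I => hE.isTorsionFree) x
  rw [← hF, comp_finProj]
  refine Submodule.sum_mem _ (fun i _ => ?_)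
  let a : End E := x ≫ Sigma.π (fun _ : I => E) i
  exact Submodule.smul_mem _ (MulOpposite.op a) (Submodule.subset_span ⟨i, rfl⟩)

omit hX hEi hE in
theorem linearIndependent_ι (I : Type v) :
    LinearIndependent (End E)ᵐᵒᵖ (Sigma.ι (fun _ : I => E)) := by
  classical
  rw [linearIndependent_iff']
  intro s g hg i hi
  have h1 := congrArg (fun y : E ⟶ ∐ fun _ : I => E => y ≫ Sigma.π (fun _ : I => E) i) hg
  simp only [Preadditive.sum_comp, zero_comp] at h1
  rw [Finset.sum_eq_single i] at h1
  · apply MulOpposite.unop_injective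
    have h2 : ((g i).unop ≫ Sigma.ι (fun _ : I => E) i) ≫ Sigma.π (fun _ : I => E) i = 0 := h1
    rw [Category.assoc, Sigma.ι_π_eq_id, Category.comp_id] at h2
    exact h2
  · intro j _ hji
    have h2 : ((g j).unop ≫ Sigma.ι (fun _ : I => E) j) ≫ Sigma.π (fun _ : I => E) i = 0 := by
      rw [Category.assoc, Sigma.ι_π_of_ne _ hji, comp_zero]
    exact h2
  · exact fun h => absurd hi h

omit hX in
theorem isEquivalence_sumsToModule : (sumsToModule E).IsEquivalence where
  faithful := ⟨fun {I J f g} h => by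
    apply InducedCategory.Hom.ext
    apply Sigma.hom_ext
    intro i
    exact congrArg (fun φ => φ.hom (Sigma.ι (fun _ : I => E) i)) h⟩
  full := ⟨fun {I J} φ => by
    refine ⟨⟨Sigma.desc (fun i => φ.hom (Sigma.ι (fun _ : I => E) i))⟩, ?_⟩
    apply ModuleCat.hom_ext
    refine LinearMap.ext_on (span_range_ι hE I) ?_
    rintro _ ⟨i, rfl⟩
    exact Sigma.ι_desc _ _⟩
  essSurj := ⟨fun V => by
    let _ := hE.divisionRingEnd hEi
    let b := Module.Basis.ofVectorSpace (End E)ᵐᵒᵖ V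
    let I := Module.Basis.ofVectorSpaceIndex (End E)ᵐᵒᵖ V
    let c : Module.Basis I (End E)ᵐᵒᵖ (E ⟶ ∐ fun _ : I => E) :=
      Module.Basis.mk (linearIndependent_ι I) (span_range_ι hE I).ge
    exact ⟨(I : Type v), ⟨(c.equiv b (Equiv.refl I)).toModuleIso⟩⟩⟩

/-- If every module is a direct sum of copies of `E` modulo `P`, then both the quotient category and
the category of right modules over the division ring `End(E)` are equivalent to the full
subcategory of `X` on the direct sums of copies of `E`. -/
theorem exists_equivalence_moduleCat (htop : ∀ N, IsSumModulo P E N) :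
    ∃ (D : Type v) (_ : DivisionRing D),
      Nonempty (P.isoModSerre.Localization ≌ ModuleCat.{v} Dᵐᵒᵖ) := by
  have := isEquivalence_sumsToQuotient hX hEi hE htop
  have := isEquivalence_sumsToModule hEi hE
  exact ⟨End E, hE.divisionRingEnd hEi,
    ⟨(sumsToQuotient P E).asEquivalence.symm.trans (sumsToModule E).asEquivalence⟩⟩

end Equivalence

end

/-! ### Quotient categories equivalent to a category of vector spaces -/

section

variable {X : Type u} [Category.{v} X] [Abelian X]

/-- A nonzero submodule `N` of `H` meets `K`, so `H / N` is an extension of a quotient of `H / K` by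
a proper quotient of `K`. -/
theorem IsInjectiveHull.isCriticalModulo {P : ObjectProperty X} [P.IsSerreClass] {K H : X}
    {i : K ⟶ H} (hi : IsInjectiveHull i) (hK : IsCriticalModulo P K) (hc : P (cokernel i)) :
    IsCriticalModulo P H := by
  have := hi.mono
  refine ⟨fun h => hK.1 (P.prop_of_mono i h), fun N f hf => ?_⟩
  have h0 : kernel.ι (i ≫ cokernel.π f) ≠ 0 := fun h => hf (by
    have := hi.essential _ (Preadditive.mono_of_kernel_zero h)
    rw [← cancel_mono (cokernel.π f), cokernel.condition, zero_comp])
  let g := cokernel.desc (kernel.ι (i ≫ cokernel.π f)) (i ≫ cokernel.π f) (kernel.condition _)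
  have hg : i ≫ cokernel.π f ≫ cokernel.π g = 0 := by
    have h1 : cokernel.π _ ≫ g = i ≫ cokernel.π f := cokernel.π_desc _ _ _
    rw [← Category.assoc]
    refine (congrArg (· ≫ cokernel.π g) h1.symm).trans ?_
    rw [Category.assoc, cokernel.condition, comp_zero]
  have : Epi (cokernel.desc i _ hg) := by
    have : Epi (cokernel.π i ≫ cokernel.desc i _ hg) := by
      rw [cokernel.π_desc]; infer_instance
    exact epi_of_epi (cokernel.π i) _
  exact P.prop_X₂_of_exact (ShortComplex.exact_cokernel g) (hK.2 _ h0)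
    (P.prop_of_epi (cokernel.desc i _ hg) hc)

/-- A vector space whose nonzero endomorphisms are invertible is a line: the projection to a line in
it is invertible. -/
theorem exists_linearEquiv_of_isUnit {k V : Type*} [DivisionRing k] [AddCommGroup V] [Module k V]
    [Nontrivial V] (h : ∀ f : Module.End k V, f ≠ 0 → IsUnit f) : Nonempty (k ≃ₗ[k] V) := by
  obtain ⟨x, hx⟩ := exists_ne (0 : V)
  have hinj := LinearMap.ker_toSpanSingleton k hx
  obtain ⟨l, hl⟩ := LinearMap.exists_leftInverse_of_injective (LinearMap.toSpanSingleton k V x) hinj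
  have hl1 : l x = 1 := by simpa using LinearMap.congr_fun hl 1
  have hu := h (LinearMap.toSpanSingleton k V x ∘ₗ l) (fun h0 => hx (by
    simpa [hl1] using LinearMap.congr_fun h0 x))
  have hb := (Module.End.isUnit_iff _).1 hu
  exact ⟨LinearEquiv.ofBijective _ ⟨LinearMap.ker_eq_bot.1 hinj,
    Function.Surjective.of_comp hb.2⟩⟩

section QuotientOfModules

variable {P : ObjectProperty X} [P.IsSerreClass] {D : Type v} [DivisionRing D]
  (Φ : P.isoModSerre.Localization ≌ ModuleCat.{v} Dᵐᵒᵖ)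

/-- The composition of the quotient functor with an equivalence of the quotient category with a
category of modules. -/
noncomputable abbrev quotientToModule : X ⥤ ModuleCat.{v} Dᵐᵒᵖ :=
  P.isoModSerre.Q ⋙ Φ.functor

instance additive_quotientToModule : (quotientToModule Φ).Additive := by
  have := ObjectProperty.SerreClassLocalization.hasFiniteProducts P.isoModSerre.Q P
  have : Φ.functor.Additive := Functor.additive_of_preserves_binary_products _
  infer_instance

theorem nontrivial_quotientToModule_obj {M : X} (hM : ¬ P M) :
    Nontrivial ((quotientToModule Φ).obj M) := by
  by_contra h
  rw [not_nontrivial_iff_subsingleton] at h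
  refine hM ((ObjectProperty.SerreClassLocalization.isZero_obj_iff P.isoModSerre.Q P M).1 ?_)
  have h1 : IsZero (Φ.functor.obj (P.isoModSerre.Q.obj M)) :=
    ModuleCat.isZero_of_subsingleton ((quotientToModule Φ).obj M)
  rw [IsZero.iff_id_eq_zero]
  exact Φ.functor.map_injective (h1.eq_of_src _ _)

include Φ

theorem exists_not_prop : ∃ M : X, ¬ P M := by
  have := Localization.essSurj P.isoModSerre.Q P.isoModSerre
  have : (quotientToModule Φ).EssSurj := inferInstance
  refine ⟨(quotientToModule Φ).objPreimage (ModuleCat.of _ Dᵐᵒᵖ), fun h => ?_⟩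
  have h1 : IsZero ((quotientToModule Φ).obj _) := Φ.functor.map_isZero
    ((ObjectProperty.SerreClassLocalization.isZero_obj_iff P.isoModSerre.Q P _).2 h)
  have h2 := h1.of_iso ((quotientToModule Φ).objObjPreimageIso (ModuleCat.of _ Dᵐᵒᵖ)).symm
  have := ModuleCat.subsingleton_of_isZero h2
  exact not_subsingleton Dᵐᵒᵖ this

theorem exists_ne_zero_of_isTorsionFree {K E : X} (hK : ¬ P K) (hEi : Injective E)
    (hE : IsTorsionFree P E) (hE0 : ¬ P E) : ∃ f : K ⟶ E, f ≠ 0 := by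
  have := nontrivial_quotientToModule_obj Φ hK
  have := nontrivial_quotientToModule_obj Φ hE0
  obtain ⟨φ, hφ⟩ : ∃ φ : (quotientToModule Φ).obj K →ₗ[Dᵐᵒᵖ] (quotientToModule Φ).obj E,
      φ ≠ 0 := exists_ne _
  obtain ⟨f, hf⟩ := (hE.map_bijective hEi K).2 (Φ.functor.preimage (ModuleCat.ofHom φ))
  refine ⟨f, fun h => hφ ?_⟩
  have h1 : (quotientToModule Φ).map f = ModuleCat.ofHom φ := by
    refine (congrArg Φ.functor.map hf).trans ?_
    rw [Functor.map_preimage]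
  rw [h, Functor.map_zero] at h1
  exact (congrArg ModuleCat.Hom.hom h1).symm

/-- Any nonzero morphism from a critical module to an injective critical module is a hull, and there
is one because both modules become nonzero vector spaces in the quotient category. -/
theorem IsCriticalModulo.exists_isInjectiveHull {K E : X} (hK : IsCriticalModulo P K)
    (hE : IsCriticalModulo P E) (hEi : Injective E) : ∃ i : K ⟶ E, IsInjectiveHull i := by
  obtain ⟨i, hi⟩ := exists_ne_zero_of_isTorsionFree Φ hK.1 hEi hE.isTorsionFree hE.1
  have := hK.mono_of_ne_zero hE.isTorsionFree i hi
  exact ⟨i, hE.isInjectiveHull hEi i hi⟩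

/-- The injective hull `H` of a critical module `K` is critical. In the quotient category, `K` is a
direct summand of `H`; the projection to `K` corresponds to an endomorphism of `H` that fixes `K`,
which is an automorphism as `H` is indecomposable. So `K` and `H` agree modulo `P`. -/
theorem IsInjectiveHull.isCriticalModulo_of_equivalence {K H : X} {i : K ⟶ H}
    (hi : IsInjectiveHull i) (hK : IsCriticalModulo P K) : IsCriticalModulo P H := by
  refine hi.isCriticalModulo hK ?_
  have := hi.mono
  have := ObjectProperty.SerreClassLocalization.preservesMonomorphisms P.isoModSerre.Q P
  have hm : Mono ((quotientToModule Φ).map i) := inferInstance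
  obtain ⟨l, hl⟩ := LinearMap.exists_leftInverse_of_injective
    ((quotientToModule Φ).map i).hom ((ModuleCat.mono_iff_ker_eq_bot _).1 hm)
  let r := Φ.functor.preimage (ModuleCat.ofHom l)
  have hr : P.isoModSerre.Q.map i ≫ r = 𝟙 _ := Φ.functor.map_injective (by
    rw [Functor.map_comp, Functor.map_preimage, CategoryTheory.Functor.map_id]
    exact ModuleCat.hom_ext hl)
  have hH := hi.isTorsionFree hK.isTorsionFree
  obtain ⟨e, he⟩ := (hH.map_bijective hi.injective H).2 (r ≫ P.isoModSerre.Q.map i)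
  have hie : i ≫ e = i := (hH.map_bijective hi.injective K).1 (by
    dsimp only at he ⊢
    rw [Functor.map_comp, he, ← Category.assoc, hr, Category.id_comp])
  have : Mono e := hi.essential e (by rw [hie]; infer_instance)
  have : IsIso e := isIso_of_indecomposable_of_mono hi.injective
    (fun hz => hK.not_isZero (hz.of_mono i)) (hi.indecomposable hK) e
  have : IsIso (r ≫ P.isoModSerre.Q.map i) := by rw [← he]; infer_instance
  have : Epi (P.isoModSerre.Q.map i) := epi_of_epi r _
  have : IsSplitMono (P.isoModSerre.Q.map i) := ⟨⟨⟨r, hr⟩⟩⟩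
  have : IsIso (P.isoModSerre.Q.map i) := isIso_of_epi_of_isSplitMono _
  exact ((ObjectProperty.SerreClassLocalization.isIso_map_iff P.isoModSerre.Q P i).1 this).2

/-- Since `E` is torsion-free and injective, its endomorphisms are those of the corresponding vector
space. -/
noncomputable def endRingEquivModuleEnd {E : X} (hE : IsTorsionFree P E) (hEi : Injective E) :
    End E ≃+* Module.End Dᵐᵒᵖ ((quotientToModule Φ).obj E) :=
  RingEquiv.ofBijective
    ({ toFun := fun f => ((quotientToModule Φ).map f).hom
       map_one' := by
        change ((quotientToModule Φ).map (𝟙 E)).hom = LinearMap.id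
        rw [CategoryTheory.Functor.map_id]; rfl
       map_mul' := fun f g => by
        change ((quotientToModule Φ).map ((g : E ⟶ E) ≫ (f : E ⟶ E))).hom = _
        rw [Functor.map_comp]; rfl
       map_zero' := by
        change ((quotientToModule Φ).map (0 : E ⟶ E)).hom = 0
        rw [Functor.map_zero]; rfl
       map_add' := fun f g => by
        change ((quotientToModule Φ).map ((f : E ⟶ E) + (g : E ⟶ E))).hom = _
        rw [Functor.map_add]; rfl } : End E →+* _)
    ⟨fun f g h => (hE.map_bijective hEi E).1 (Φ.functor.map_injective (ModuleCat.hom_ext h)),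
      fun φ => by
        obtain ⟨f, hf⟩ := (hE.map_bijective hEi E).2 (Φ.functor.preimage (ModuleCat.ofHom φ))
        refine ⟨f, ?_⟩
        have h1 : (quotientToModule Φ).map f = ModuleCat.ofHom φ := by
          refine (congrArg Φ.functor.map hf).trans ?_
          rw [Functor.map_preimage]
        exact congrArg ModuleCat.Hom.hom h1⟩

theorem IsCriticalModulo.nonempty_ringEquiv_residueRing {E : X} (hE : IsCriticalModulo P E)
    (hEi : Injective E) : Nonempty (D ≃+* residueRing E) := by
  let a := endRingEquivModuleEnd Φ hE.isTorsionFree hEi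
  have := nontrivial_quotientToModule_obj Φ hE.1
  obtain ⟨b⟩ := exists_linearEquiv_of_isUnit (k := Dᵐᵒᵖ) (V := (quotientToModule Φ).obj E)
    (fun f hf => by
      have h := (hE.isUnit_or_eq_zero hEi (a.symm f)).resolve_right
        (fun h0 => hf (by simpa using h0))
      simpa using h.map a)
  obtain ⟨c⟩ := hE.nonempty_end_ringEquiv_residueRing hEi
  exact ⟨(RingEquiv.opOp D).trans ((RingEquiv.moduleEndSelf Dᵐᵒᵖ).trans
    (b.conjRingEquiv.trans (a.symm.trans c)))⟩

end QuotientOfModules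

end

/-! ### The category `σ[E]` and the equivalence of the conditions -/

section

variable {X : Type u} [Category.{v} X] [Abelian X]

/-- Both `E'` and `E` are injective hulls of their common critical submodule `K`. -/
theorem IsCriticalModulo.nonempty_iso_of_mono [IsGrothendieckAbelian.{v} X] {P : ObjectProperty X}
    [P.IsSerreClass] {K E E' : X} (hK : IsCriticalModulo P K) (hE : IsCriticalModulo P E)
    (hEi : Injective E) (hEi' : Injective E') (hE' : Indecomposable E') (k : K ⟶ E') [Mono k]
    (i : K ⟶ E) [Mono i] : Nonempty (E' ≅ E) := by
  have hk := IsInjectiveHull.of_indecomposable hEi' hE' k hK.not_isZero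
  have : Mono (Injective.factorThru i k) :=
    hk.essential _ (by rw [Injective.comp_factorThru]; infer_instance)
  have := isIso_of_indecomposable_of_mono hEi' hE'.1 (hE.indecomposable hEi)
    (Injective.factorThru i k)
  exact ⟨asIso (Injective.factorThru i k)⟩

section Sigma

omit [Abelian X] in
theorem isWeaklyClosed_sigma (E : X) : IsWeaklyClosed (sigma E) where
  subobjects := ⟨fun f _ h Q hQ hE => by
    have := hQ.subobjects
    exact Q.prop_of_mono f (h Q hQ hE)⟩
  quotients := ⟨fun f _ h Q hQ hE => by
    have := hQ.quotients
    exact Q.prop_of_epi f (h Q hQ hE)⟩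
  directSums J := ⟨fun Y hY Q hQ hE => by
    obtain ⟨h⟩ := hY
    have := hQ.directSums J
    exact Q.prop_of_isColimit h.isColimit (fun j => h.prop_diag_obj j Q hQ hE)⟩

omit [Abelian X] in
theorem sigma_self (E : X) : sigma E E := fun _ _ h => h

variable [IsGrothendieckAbelian.{v} X] {P : ObjectProperty X} [P.IsSerreClass] {E : X}
  (hX : IsLocallyNoetherian X)
  (hP : ∀ J : Type v, P.IsClosedUnderColimitsOfShape (Discrete J))
  (hEi : Injective E) (hE : IsCriticalModulo P E)

include hX hP hEi hE

theorem isWeaklyClosed_isSumModulo : IsWeaklyClosed (IsSumModulo P E) where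
  subobjects := isClosedUnderSubobjects_isSumModulo hX hP hEi hE
  quotients := isClosedUnderQuotients_isSumModulo hX hP hEi hE
  directSums := isClosedUnderColimitsOfShape_isSumModulo hX hP hEi hE

/-- A morphism `N ⟶ ∐ E` that is an isomorphism modulo `P` makes `N` an extension of its image,
which is in `σ[E]`, by its kernel, which is in `P`. Conversely, an extension of a module in `σ[E]`
by a module in `P` is isomorphic to the former modulo `P`. -/
theorem gabrielProduct_sigma_eq_top_iff :
    gabrielProduct (sigma E) P = ⊤ ↔ ∀ N, IsSumModulo P E N := by
  refine ⟨fun h N => ?_, fun h => ?_⟩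
  · obtain ⟨M₂, M₁, f, g, w, hs, h₁, h₂⟩ : gabrielProduct (sigma E) P N := by rw [h]; trivial
    have := hs.mono_f
    have := hs.epi_g
    have h3 : IsSumModulo P E M₁ :=
      h₁ _ (isWeaklyClosed_isSumModulo hX hP hEi hE) isSumModulo_self
    refine (isSumModulo_iff_of_isoModSerre g ⟨?_, ?_⟩).2 h3
    · exact P.prop_of_iso (IsLimit.conePointUniqueUpToIso hs.fIsKernel (limit.isLimit _)) h₂
    · exact P.prop_of_isZero (isZero_cokernel_of_epi g)
  · refine top_unique (fun N _ => ?_)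
    obtain ⟨I, f, hf⟩ := IsSumModulo.exists_isoModSerre hX hEi hE (h N)
    have hσ := isWeaklyClosed_sigma E
    have := hσ.subobjects
    have := hσ.directSums I
    refine ⟨kernel f, Abelian.image f, kernel.ι f, Abelian.factorThruImage f, ?_, ?_, ?_, hf.1⟩
    · rw [← cancel_mono (Abelian.image.ι f)]
      simp
    · exact
        { exact := by
            refine ShortComplex.exact_of_f_is_kernel _ (KernelFork.IsLimit.ofι' _ _ ?_)
            intro A x hx
            exact kernel.lift' f x (by
              rw [← Abelian.image.fac f, ← Category.assoc]
              exact (congrArg (· ≫ Abelian.image.ι f) hx).trans zero_comp) }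
    · exact (sigma E).prop_of_mono (Abelian.image.ι f)
        ((sigma E).prop_colimit _ (fun _ => sigma_self E))

end Sigma

end

end NCSpace

theorem mainTheorem2 (X : Type u) [Category.{v} X] [Abelian X] [IsGrothendieckAbelian.{v} X]
    (hX : NCSpace.IsLocallyNoetherian X)
    (δ : NCSpace.DimensionFunction.{w} X) (α : Ordinal.{w}) (hα : δ.SpaceDimEq α)
    (hloc : ∀ J : Type v, (δ.ltSubcategory α).IsClosedUnderColimitsOfShape (Discrete J)) :
    List.TFAE [
      -- (a) `X / C_{<α}` is equivalent to the category of right `D`-modules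
      ∃ (D : Type v) (_ : DivisionRing D),
        Nonempty (δ.QuotientCategory α ≌ ModuleCat.{v} Dᵐᵒᵖ),
      -- (b)
      ∃ E : X, Injective E ∧ δ.IsCritical α E ∧
        ∀ E' : X, δ.IsIndecInjectiveOfCriticalDim α E' → Nonempty (E' ≅ E),
      -- (c)
      ∃ E : X, Injective E ∧ δ.IsCritical α E ∧
        NCSpace.gabrielProduct (NCSpace.sigma E) (δ.ltSubcategory α) = ⊤ ] ∧
    -- in this case:
    ((∃ (D : Type v) (_ : DivisionRing D),
        Nonempty (δ.QuotientCategory α ≌ ModuleCat.{v} Dᵐᵒᵖ)) →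
      ∀ E : X, Injective E → δ.IsCritical α E →
        (∀ (D : Type v) [DivisionRing D],
          Nonempty (δ.QuotientCategory α ≌ ModuleCat.{v} Dᵐᵒᵖ) →
            Nonempty (D ≃+* NCSpace.residueRing E)) ∧
        ∀ M : X, δ.IsCritical α M → ∃ i : M ⟶ E, NCSpace.IsInjectiveHull i) := by
  have hle : ∀ M, δ.dim M ≤ (α : WithBot Ordinal.{w}) := fun M => hα.1 ⟨M, rfl⟩
  simp only [NCSpace.DimensionFunction.IsIndecInjectiveOfCriticalDim, δ.isCritical_iff hle]
  refine ⟨?_, ?_⟩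
  · tfae_have 1 → 2
    | ⟨D, _, ⟨Φ⟩⟩ => by
      obtain ⟨N, hN⟩ := NCSpace.exists_not_prop Φ
      obtain ⟨K, hK⟩ := δ.exists_isCriticalModulo hX hle hloc hN
      obtain ⟨E, i, hi⟩ := NCSpace.exists_isInjectiveHull K
      have hE := hi.isCriticalModulo_of_equivalence Φ hK
      refine ⟨E, hi.injective, hE, fun E' ⟨hEi', hE', S, hS⟩ => ?_⟩
      obtain ⟨j, hj⟩ := hS.exists_isInjectiveHull Φ hE hi.injective
      have := hj.mono
      exact hS.nonempty_iso_of_mono hE hi.injective hEi' hE' S.arrow j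
    tfae_have 2 → 3
    | ⟨E, hEi, hE, huniq⟩ => by
      refine ⟨E, hEi, hE, (NCSpace.gabrielProduct_sigma_eq_top_iff hX hloc hEi hE).2 ?_⟩
      have hw := NCSpace.isWeaklyClosed_isSumModulo hX hloc hEi hE
      have := hw.quotients
      have := NCSpace.isClosedUnderExtensions_isSumModulo hX hEi hE
      refine δ.prop_of_isCriticalModulo hX hle _ hw.directSums
        (fun N hN => NCSpace.isSumModulo_of_prop hN) (fun K hK => ?_)
      -- the injective hull of `K` is indecomposable and contains `K`, so it is `E`
      obtain ⟨H, i, hi⟩ := NCSpace.exists_isInjectiveHull K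
      have := hi.mono
      obtain ⟨e⟩ := huniq H ⟨hi.injective, hi.indecomposable hK, Subobject.mk i,
        hK.of_iso (Subobject.underlyingIso i).symm⟩
      exact NCSpace.isSumModulo_of_mono hE (i ≫ e.hom) (fun h => hK.not_isZero
        (IsZero.of_mono_eq_zero _ h))
    tfae_have 3 → 1
    | ⟨E, hEi, hE, h⟩ => NCSpace.exists_equivalence_moduleCat hX hEi hE
        ((NCSpace.gabrielProduct_sigma_eq_top_iff hX hloc hEi hE).1 h)
    tfae_finish
  · rintro ⟨D, _, ⟨Φ⟩⟩ E hEi hE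
    exact ⟨fun D _ ⟨Ψ⟩ => hE.nonempty_ringEquiv_residueRing Ψ hEi,
      fun M hM => hM.exists_isInjectiveHull Φ hE hEi⟩
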